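/- Let $n\ge 1$. Consider polynomials over $\mathbb{Q}[\beta]$ in commuting variables $x_{ij}$, $1\le i<j\le n+1$, with the reduction rule $$x_{ij}x_{jk}\;\to\; x_{ik}x_{ij}+x_{jk}x_{ik}+\beta x_{ik}\qquad(i<j<k),$$ applied to one term at a time (like terms may be collected or kept apart). A reduced form of a monomial is a polynomial obtained from it by successive reductions, no term of which is divisible by any $x_{ij}x_{jk}$ with $i<j<k$. Let $w_{\mathcal S}=x_{12}x_{23}\cdots x_{n,n+1}$, and let $s_{n,k}$ be the number of ways to draw $k$ diagonals of a convex $(n+2)$-gon that do not intersect in their interiors. A graph on $[n+1]=\{1,\dots,n+1\}$ is noncrossing if there are no $i<j<k<l$ such that $(i,k)$ and $(j,l)$ are edges, and alternating if there are no $i<j<k$ such that $(i,j)$ and $(j,k)$ are edges. An $\mathcal S$-reduction tree with root $G_0$ is a finite tree whose nodes are labeled by graphs on $[n+1]$, with root labeled $G_0$: a node whose label $G$ is alternating is a leaf; at every other node one chooses edges $(i,j),(j,k)$ of its label $G$ with $i<j<k$, and the node has three children, labeled by the graphs with edge sets $E(G)\setminus\{(j,k)\}\cup\{(i,k)\}$,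 $E(G)\setminus\{(i,j)\}\cup\{(i,k)\}$ and $E(G)\setminus\{(i,j),(j,k)\}\cup\{(i,k)\}$. Then: (1) Every reduced form $P$ of $w_{\mathcal S}$ satisfies $$P(x_{ij}=1)=\sum_{m=0}^{n-1}s_{n,n-m-1}\,\beta^m .$$ In particular, $P(x_{ij}=1,\ \beta=0)$ is the Catalan number $C_n=\frac1{n+1}\binom{2n}{n}$. (2) For every $k\ge 0$, $$s_{n,k}=\frac{1}{n+1}\binom{n+k+1}{n}\binom{n-1}{k}.$$ (3) For every $k\ge 0$ there is a bijection between the set of noncrossing alternating forests on $[n+1]$ with $k+1$ edges that contain the edge $(1,n+1)$ and the set of ways to draw $k$ diagonals of a convex $(n+2)$-gon that do not intersect in their interiors. In particular, there are exactly $s_{n,k}$ such forests. (4) For every $k\ge 0$, in every $\mathcal S$-reduction tree whose root is the path with edges $(1,2),(2,3),\dots,(n,n+1)$, exactly $s_{n,k}$ leaves are labeled by graphs with $k+1$ edges. -/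

import Mathlib

namespace SubdivisionAlgebra

/-- The pairs `i < j` of vertices; `Fin (n + 1)` plays the role of `[n + 1] = {1, …, n + 1}`, so the
vertex `1` is `0` and the vertex `n + 1` is `Fin.last n`. They index the variables `x_{ij}` and are
the possible edges of a graph on `[n + 1]`. -/
abbrev Edge (n : ℕ) : Type := {e : Fin (n + 1) × Fin (n + 1) // e.1 < e.2}

/-- The edge `(i, j)`, for `i < j`. -/
def edge {n : ℕ} {i j : Fin (n + 1)} (h : i < j) : Edge n := ⟨(i, j), h⟩

/-! ### Reduced forms in the commuting variables -/

/-- Polynomials in the commuting variables `x_{ij}`, `i < j`, over `ℚ[β]`. -/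
abbrev Poly (n : ℕ) : Type := MvPolynomial (Edge n) (Polynomial ℚ)

/-- The variable `x_{ij}`. -/
noncomputable def x {n : ℕ} {i j : Fin (n + 1)} (h : i < j) : Poly n := MvPolynomial.X (edge h)

/-- The central variable `β`. -/
noncomputable def beta (n : ℕ) : Poly n := MvPolynomial.C Polynomial.X

/-- The path monomial `w = x_{12} x_{23} ⋯ x_{n,n+1}`. -/
noncomputable def pathMonomial (n : ℕ) : Poly n := ∏ i : Fin n, x (Fin.castSucc_lt_succ (i := i))

/-- The term `c β^a x^d`. -/
noncomputable def term {n : ℕ} (c : ℚ) (a : ℕ) (d : Edge n →₀ ℕ) : Poly n :=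
  MvPolynomial.monomial d (Polynomial.monomial a c)

/-- `p'` is obtained from `p` by applying the reduction rule
`x_{ij} x_{jk} → x_{ik} x_{ij} + x_{jk} x_{ik} + β x_{ik}` to one term `c β^a x^d x_{ij} x_{jk}`
of `p`. If like terms are collected then `c` is the whole coefficient; allowing every
`0 < c ≤ coefficient` also covers sums in which like terms are kept apart and reduced differently.
-/
def ReducesTo {n : ℕ} (p p' : Poly n) : Prop :=
  ∃ (i j k : Fin (n + 1)) (hij : i < j) (hjk : j < k) (d : Edge n →₀ ℕ) (a : ℕ) (c : ℚ),
    0 < c ∧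
    c ≤ (p.coeff (d + Finsupp.single (edge hij) 1 + Finsupp.single (edge hjk) 1)).coeff a ∧
    p' = p - term c a d * (x hij * x hjk)
      + term c a d * (x (hij.trans hjk) * x hij + x hjk * x (hij.trans hjk)
          + beta n * x (hij.trans hjk))

/-- No term of `p` is divisible by any `x_{ij} x_{jk}` with `i < j < k`. -/
def IsFullyReduced {n : ℕ} (p : Poly n) : Prop :=
  ∀ d ∈ p.support, ∀ (i j k : Fin (n + 1)) (hij : i < j) (hjk : j < k),
    ¬ (Finsupp.single (edge hij) 1 + Finsupp.single (edge hjk) 1 ≤ d)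

/-- `P` is a reduced form of `w`: it is reached from `w` by successive reductions, and no further
reduction is possible. -/
def IsReducedForm {n : ℕ} (w P : Poly n) : Prop :=
  Relation.ReflTransGen ReducesTo w P ∧ IsFullyReduced P

/-! ### Graphs on `[n + 1]` and reduction trees -/

/-- A graph on the vertex set `[n + 1]`, given by its edge set. -/
abbrev Graph (n : ℕ) : Type := Finset (Edge n)

/-- The underlying simple graph. -/
def Graph.toSimpleGraph {n : ℕ} (G : Graph n) : SimpleGraph (Fin (n + 1)) :=
  SimpleGraph.fromEdgeSet {s | ∃ e ∈ G, s = s(e.1.1, e.1.2)}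

def Graph.IsForest {n : ℕ} (G : Graph n) : Prop := (Graph.toSimpleGraph G).IsAcyclic

/-- There are no `i < j < k < l` such that `(i, k)` and `(j, l)` are edges. -/
def Graph.IsNoncrossing {n : ℕ} (G : Graph n) : Prop :=
  ∀ (i j k l : Fin (n + 1)) (hij : i < j) (hjk : j < k) (hkl : k < l),
    ¬ (edge (hij.trans hjk) ∈ G ∧ edge (hjk.trans hkl) ∈ G)

/-- There are no `i < j < k` such that `(i, j)` and `(j, k)` are edges. -/
def Graph.IsAlternating {n : ℕ} (G : Graph n) : Prop :=
  ∀ (i j k : Fin (n + 1)) (hij : i < j) (hjk : j < k), ¬ (edge hij ∈ G ∧ edge hjk ∈ G)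

/-- The noncrossing alternating forests on `[n + 1]` with `k` edges that contain the edge
`(1, n + 1)`. -/
def noncrossingAlternatingForests (n k : ℕ) : Set (Graph n) :=
  {F | Graph.IsForest F ∧ Graph.IsNoncrossing F ∧ Graph.IsAlternating F ∧ F.card = k ∧
    ∃ e ∈ F, e.1 = (0, Fin.last n)}

/-- The path `1 - 2 - ⋯ - (n + 1)`. -/
def pathGraph (n : ℕ) : Graph n :=
  Finset.univ.image fun i : Fin n => edge (Fin.castSucc_lt_succ (i := i))

/-- `S`-reduction trees with root labeled by `G`. An inner node labeled `G`, at which the reduction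
is performed on the edges `(i, j)`, `(j, k)` of `G`, has the three children labeled
`G \ {(j, k)} ∪ {(i, k)}`, `G \ {(i, j)} ∪ {(i, k)}` and `G \ {(i, j), (j, k)} ∪ {(i, k)}`;
a leaf is labeled by a graph to which no reduction applies. -/
inductive ReductionTree {n : ℕ} : Graph n → Type
  | leaf (G : Graph n) (hG : Graph.IsAlternating G) : ReductionTree G
  | node (G : Graph n) (i j k : Fin (n + 1)) (hij : i < j) (hjk : j < k)
      (h₁ : edge hij ∈ G) (h₂ : edge hjk ∈ G)
      (T₁ : ReductionTree (insert (edge (hij.trans hjk)) (G.erase (edge hjk))))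
      (T₂ : ReductionTree (insert (edge (hij.trans hjk)) (G.erase (edge hij))))
      (T₃ : ReductionTree
        (insert (edge (hij.trans hjk)) ((G.erase (edge hij)).erase (edge hjk)))) :
      ReductionTree G

/-- The number of leaves labeled by graphs with exactly `k` edges. -/
def ReductionTree.leafCount {n : ℕ} (k : ℕ) : {G : Graph n} → ReductionTree G → ℕ
  | _, .leaf G _ => if G.card = k then 1 else 0
  | _, .node _ _ _ _ _ _ _ _ T₁ T₂ T₃ => T₁.leafCount k + T₂.leafCount k + T₃.leafCount k

/-! ### Dissections of a convex polygon -/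

/-- `(a, b)` with `a < b` is a diagonal of the convex polygon with the `N` vertices
`0, …, N - 1` in cyclic order: `a` and `b` are neither equal nor adjacent. -/
def IsDiagonal {N : ℕ} (p : Fin N × Fin N) : Prop :=
  p.1.val + 1 < p.2.val ∧ ¬ (p.1.val = 0 ∧ p.2.val + 1 = N)

/-- The diagonals `p` and `q` of a convex polygon intersect in their interiors: the endpoints
alternate around the polygon. -/
def Crosses {N : ℕ} (p q : Fin N × Fin N) : Prop :=
  (p.1 < q.1 ∧ q.1 < p.2 ∧ p.2 < q.2) ∨ (q.1 < p.1 ∧ p.1 < q.2 ∧ q.2 < p.2)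

/-- The ways to draw `k` diagonals of a convex `(n + 2)`-gon that do not intersect in their
interiors. -/
def dissections (n k : ℕ) : Set (Finset (Fin (n + 2) × Fin (n + 2))) :=
  {D | (∀ p ∈ D, IsDiagonal p) ∧ (∀ p ∈ D, ∀ q ∈ D, ¬ Crosses p q) ∧ D.card = k}

/-- The number `s_{n,k}` of ways to draw `k` diagonals of a convex `(n + 2)`-gon that do not
intersect in their interiors. -/
noncomputable def dissectionNumber (n k : ℕ) : ℕ := (dissections n k).ncard

end SubdivisionAlgebra

namespace SubdivisionAlgebra

open Finset

/-! ### Noncrossing alternating families of pairs of natural numbers -/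

/-- The pairs `(i, j)` with `a ≤ i < j ≤ a + l`. -/
def pairsIn (a l : ℕ) : Finset (ℕ × ℕ) :=
  (range (a + l + 1) ×ˢ range (a + l + 1)).filter fun e => a ≤ e.1 ∧ e.1 < e.2

lemma mem_pairsIn {a l : ℕ} {e : ℕ × ℕ} :
    e ∈ pairsIn a l ↔ a ≤ e.1 ∧ e.1 < e.2 ∧ e.2 ≤ a + l := by
  simp only [pairsIn, mem_filter, mem_product, mem_range]
  omega

/-- The family is both noncrossing and alternating. -/
def Compatible (G : Finset (ℕ × ℕ)) : Prop :=
  ∀ e ∈ G, ∀ f ∈ G, ¬ (e.1 < f.1 ∧ f.1 ≤ e.2 ∧ e.2 < f.2)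

instance : DecidablePred Compatible := fun G => by unfold Compatible; infer_instance

/-- The noncrossing alternating families of pairs in `[a, a + l]`. -/
def families (a l : ℕ) : Finset (Finset (ℕ × ℕ)) := (pairsIn a l).powerset.filter Compatible

/-- Those noncrossing alternating families in `[a, a + l]` that contain `(a, a + l)`. -/
def fullFamilies (a l : ℕ) : Finset (Finset (ℕ × ℕ)) :=
  (families a l).filter fun G => (a, a + l) ∈ G

lemma mem_families {a l : ℕ} {G : Finset (ℕ × ℕ)} :
    G ∈ families a l ↔ G ⊆ pairsIn a l ∧ Compatible G := by
  simp [families]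

lemma mem_fullFamilies {a l : ℕ} {G : Finset (ℕ × ℕ)} :
    G ∈ fullFamilies a l ↔ G ⊆ pairsIn a l ∧ Compatible G ∧ (a, a + l) ∈ G := by
  simp [fullFamilies, mem_families, and_assoc]

lemma Compatible.mono {G H : Finset (ℕ × ℕ)} (hG : Compatible G) (h : H ⊆ G) : Compatible H :=
  fun e he f hf => hG e (h he) f (h hf)

/-! ### Weighted sums over families and their decomposition -/

section Sums

variable {R : Type*} [CommRing R] (u : ℕ × ℕ → R)

/-- The sum of the weights of all families in `[a, a + l]`. -/
def familySum (a l : ℕ) : R := ∑ G ∈ families a l, ∏ e ∈ G, u e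

/-- The sum of the weights of the families in `[a, a + l]` that contain `(a, a + l)`. -/
def fullSum (a l : ℕ) : R := ∑ G ∈ fullFamilies a l, ∏ e ∈ G, u e

/-- `fullSum`, with the value `1` for the interval reduced to a point. -/
def fullSum' (a l : ℕ) : R := if l = 0 then 1 else fullSum u a l

/-- The sum of the weights of the families in `[a, a + l]` that do not contain `(a, a + l)`. -/
def properSum (a l : ℕ) : R :=
  ∑ G ∈ (families a l).filter (fun G => (a, a + l) ∉ G), ∏ e ∈ G, u e

lemma familySum_eq_add (a l : ℕ) : familySum u a l = fullSum u a l + properSum u a l := by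
  simp only [familySum, fullSum, properSum, fullFamilies]
  exact (sum_filter_add_sum_filter_not _ _ _).symm

lemma pairsIn_zero (a : ℕ) : pairsIn a 0 = ∅ := by
  ext e
  simp only [mem_pairsIn, notMem_empty, iff_false]
  omega

lemma familySum_zero (a : ℕ) : familySum u a 0 = 1 := by
  have : families a 0 = {∅} := by
    ext G
    simp only [mem_families, pairsIn_zero, subset_empty, mem_singleton]
    constructor
    · exact fun h => h.1
    · rintro rfl
      exact ⟨rfl, fun e he => by simp at he⟩
  simp [familySum, this]

/-- No pair inside the interval can cross or continue the longest pair, so that pair may be added or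
removed freely. -/
lemma fullSum_eq_mul {a l : ℕ} (hl : 0 < l) :
    fullSum u a l = u (a, a + l) * properSum u a l := by
  rw [fullSum, properSum, mul_sum]
  symm
  refine sum_bij' (fun G _ => insert (a, a + l) G) (fun G _ => G.erase (a, a + l)) ?_ ?_ ?_ ?_ ?_
  · intro G hG
    simp only [mem_filter, mem_families] at hG
    obtain ⟨⟨hs, hc⟩, hn⟩ := hG
    rw [mem_fullFamilies]
    refine ⟨?_, ?_, mem_insert_self _ _⟩
    · refine insert_subset ?_ hs
      rw [mem_pairsIn]; dsimp only; omega
    · intro e he f hf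
      have he' : a ≤ e.1 ∧ e.2 ≤ a + l := by
        rcases mem_insert.1 he with rfl | he
        · simp
        · have := mem_pairsIn.1 (hs he); omega
      have hf' : a ≤ f.1 ∧ f.2 ≤ a + l := by
        rcases mem_insert.1 hf with rfl | hf
        · simp
        · have := mem_pairsIn.1 (hs hf); omega
      rcases mem_insert.1 he with rfl | he
      · dsimp only; omega
      rcases mem_insert.1 hf with rfl | hf
      · dsimp only; omega
      exact hc e he f hf
  · intro G hG
    rw [mem_fullFamilies] at hG
    simp only [mem_filter, mem_families]
    exact ⟨⟨(erase_subset _ _).trans hG.1, hG.2.1.mono (erase_subset _ _)⟩, notMem_erase _ _⟩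
  · intro G hG
    exact erase_insert (mem_filter.1 hG).2
  · intro G hG
    exact insert_erase (mem_fullFamilies.1 hG).2.2
  · intro G hG
    rw [prod_insert (mem_filter.1 hG).2]

/-- The largest right end `a + c` of a pair `(a, a + c)` in the family, as the length `c`. -/
def firstLength (a : ℕ) (G : Finset (ℕ × ℕ)) : ℕ :=
  (G.filter fun e => e.1 = a).sup fun e => e.2 - a

lemma le_firstLength {a j : ℕ} {G : Finset (ℕ × ℕ)} (h : (a, j) ∈ G) :
    j ≤ a + firstLength a G := by
  have : j - a ≤ firstLength a G :=
    le_sup (f := fun e : ℕ × ℕ => e.2 - a) (b := (a, j))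
      (mem_filter.2 ⟨h, rfl⟩)
  omega

lemma firstLength_mem {a : ℕ} {G : Finset (ℕ × ℕ)} (hG : ∀ e ∈ G, a ≤ e.2)
    (h : firstLength a G ≠ 0) : (a, a + firstLength a G) ∈ G := by
  have hne : (G.filter fun e => e.1 = a).Nonempty := by
    by_contra hne
    rw [not_nonempty_iff_eq_empty] at hne
    -- An empty supremum is `0`, so length `0` encodes that no pair starts at `a`.
    exact h (by simp [firstLength, hne])
  obtain ⟨e, he, hse⟩ := exists_mem_eq_sup _ hne (fun e : ℕ × ℕ => e.2 - a)
  rw [mem_filter] at he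
  have h1 : firstLength a G = e.2 - a := hse
  have h2 := hG e he.1
  have : (a, a + firstLength a G) = e := by
    ext
    · exact he.2.symm
    · dsimp only; omega
  rw [this]; exact he.1

lemma firstLength_eq {a c : ℕ} {G : Finset (ℕ × ℕ)} (h : ∀ j, (a, j) ∈ G → j ≤ a + c)
    (hc : c = 0 ∨ (a, a + c) ∈ G) : firstLength a G = c := by
  apply le_antisymm
  · refine Finset.sup_le fun e he => ?_
    rw [mem_filter] at he
    have := h e.2 (by rw [← he.2]; exact he.1)
    omega
  · rcases hc with rfl | hc
    · exact Nat.zero_le _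
    · have := le_firstLength hc; omega

/-- A family in `[a, a + c]`, required to contain `(a, a + c)` unless `c = 0`. -/
def fullFamilies' (a c : ℕ) : Finset (Finset (ℕ × ℕ)) :=
  (families a c).filter fun G => c = 0 ∨ (a, a + c) ∈ G

lemma fullSum'_eq (a c : ℕ) : fullSum' u a c = ∑ G ∈ fullFamilies' a c, ∏ e ∈ G, u e := by
  rcases eq_or_ne c 0 with rfl | hc
  · have := familySum_zero u a
    simpa [fullSum', fullFamilies', familySum] using this.symm
  · simp [fullSum', fullFamilies', hc, fullSum, fullFamilies]

/-- Let `(a, a + c)` be the longest pair at `a`, with `c = 0` if there is none. Nothing passes from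
`[a, a + c]` to its right: pairs at `a` are no longer, and a pair from a later vertex would violate
compatibility with `(a, a + c)`. So the family splits into a full one on `[a, a + c]` and an
arbitrary one on the rest. -/
lemma properSum_succ (a l : ℕ) :
    properSum u a (l + 1) =
      ∑ q ∈ antidiagonal l, fullSum' u a q.1 * familySum u (a + q.1 + 1) q.2 := by
  have hterm : ∀ q ∈ antidiagonal l, fullSum' u a q.1 * familySum u (a + q.1 + 1) q.2 =
      ∑ G ∈ ((families a (l + 1)).filter (fun G => (a, a + (l + 1)) ∉ G)).filter
        (fun G => (firstLength a G, l - firstLength a G) = q), ∏ e ∈ G, u e := by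
    rintro ⟨c, r⟩ hq
    rw [HasAntidiagonal.mem_antidiagonal] at hq
    dsimp only at hq ⊢
    rw [fullSum'_eq, familySum, sum_mul_sum, ← sum_product']
    refine sum_bij' (fun p _ => p.1 ∪ p.2)
      (fun G _ => (G.filter (fun e => e.1 ≤ a + c), G.filter (fun e => ¬ e.1 ≤ a + c)))
      ?_ ?_ ?_ ?_ ?_
    · rintro ⟨G, H⟩ hp
      simp only [mem_product, fullFamilies', mem_filter, mem_families] at hp
      obtain ⟨⟨⟨hG, hGc⟩, hGf⟩, hH, hHc⟩ := hp
      have h1 : ∀ e ∈ G, a ≤ e.1 ∧ e.1 < e.2 ∧ e.2 ≤ a + c := fun e he => mem_pairsIn.1 (hG he)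
      have h2 : ∀ e ∈ H, a + c + 1 ≤ e.1 ∧ e.1 < e.2 ∧ e.2 ≤ a + c + 1 + r :=
        fun e he => mem_pairsIn.1 (hH he)
      have hfl : firstLength a (G ∪ H) = c := by
        refine firstLength_eq (fun j hj => ?_) (hGf.imp_right (mem_union_left _))
        rcases mem_union.1 hj with hj | hj
        · exact (h1 _ hj).2.2
        · have := (h2 _ hj).1; dsimp only at this; omega
      simp only [mem_filter, mem_families, hfl, Prod.mk.injEq]
      refine ⟨⟨⟨?_, ?_⟩, ?_⟩, trivial, by omega⟩
      · intro e he
        rw [mem_pairsIn]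
        rcases mem_union.1 he with he | he
        · have := h1 e he; omega
        · have := h2 e he; omega
      · intro e he f hf
        rcases mem_union.1 he with he | he <;> rcases mem_union.1 hf with hf | hf
        · exact hGc e he f hf
        · have := h1 e he; have := h2 f hf; omega
        · have := h2 e he; have := h1 f hf; omega
        · exact hHc e he f hf
      · intro hmem
        have := le_firstLength hmem
        omega
    · intro G hG
      simp only [mem_filter, mem_families, Prod.mk.injEq] at hG
      obtain ⟨⟨⟨hs, hc⟩, hn⟩, hf, hr⟩ := hG
      have h0 : ∀ e ∈ G, a ≤ e.1 ∧ e.1 < e.2 ∧ e.2 ≤ a + (l + 1) :=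
        fun e he => mem_pairsIn.1 (hs he)
      have hfm : c = 0 ∨ (a, a + c) ∈ G := by
        rcases eq_or_ne c 0 with h | h
        · exact Or.inl h
        · have := firstLength_mem (a := a) (G := G) (fun e he => by have := h0 e he; omega)
            (by rw [hf]; exact h)
          rw [hf] at this
          exact Or.inr this
      simp only [mem_product, fullFamilies', mem_filter, mem_families]
      refine ⟨⟨⟨?_, hc.mono (filter_subset _ _)⟩, ?_⟩, ?_, hc.mono (filter_subset _ _)⟩
      · intro e he
        rw [mem_filter] at he
        have h1 := h0 e he.1
        rw [mem_pairsIn]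
        refine ⟨h1.1, h1.2.1, ?_⟩
        rcases eq_or_ne e.1 a with hea | hea
        · have := le_firstLength (a := a) (j := e.2) (G := G) (by rw [← hea]; exact he.1)
          omega
        · rcases hfm with h | h
          · omega
          · have := hc _ h _ he.1
            dsimp only at this
            omega
      · exact hfm.imp_right fun h => ⟨h, le_rfl.trans (by omega)⟩
      · intro e he
        rw [mem_filter] at he
        have h1 := h0 e he.1
        rw [mem_pairsIn]
        omega
    · rintro ⟨G, H⟩ hp
      simp only [mem_product, fullFamilies', mem_filter, mem_families] at hp
      obtain ⟨⟨⟨hG, -⟩, -⟩, hH, -⟩ := hp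
      have h1 : ∀ e ∈ G, e.1 ≤ a + c := fun e he => by
        have := mem_pairsIn.1 (hG he); omega
      have h2 : ∀ e ∈ H, ¬ e.1 ≤ a + c := fun e he => by
        have := mem_pairsIn.1 (hH he); omega
      dsimp only
      rw [filter_union, filter_union, filter_true_of_mem h1, filter_false_of_mem h2,
        filter_true_of_mem h2, filter_false_of_mem (fun e he => not_not.2 (h1 e he))]
      simp
    · intro G _
      exact filter_union_filter_not_eq _ _
    · rintro ⟨G, H⟩ hp
      simp only [mem_product, fullFamilies', mem_filter, mem_families] at hp
      obtain ⟨⟨⟨hG, -⟩, -⟩, hH, -⟩ := hp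
      dsimp only
      rw [prod_union]
      rw [disjoint_left]
      intro e he he'
      have := mem_pairsIn.1 (hG he); have := mem_pairsIn.1 (hH he'); omega
  rw [sum_congr rfl hterm, sum_fiberwise_of_maps_to, properSum]
  intro G hG
  rw [mem_filter, mem_families] at hG
  rw [HasAntidiagonal.mem_antidiagonal]
  have : firstLength a G ≤ l := by
    by_contra hlt
    have hmem := firstLength_mem (a := a) (G := G)
      (fun e he => by have := mem_pairsIn.1 (hG.1.1 he); omega) (by omega)
    have h1 := mem_pairsIn.1 (hG.1.1 hmem)
    dsimp only at h1
    have h2 : firstLength a G = l + 1 := by omega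
    rw [h2] at hmem
    exact hG.2 hmem
  dsimp only
  omega

/-- The telescoping evaluation of the sum over the first vertex that is left uncovered. -/
lemma sum_antidiagonal_prod (v : ℕ → R) (l a : ℕ) :
    ∑ q ∈ antidiagonal l, (∏ m ∈ range q.1, v (a + m)) *
        (∏ m ∈ range q.2, (1 + v (a + q.1 + 1 + m))) =
      ∏ m ∈ range (l + 1), (1 + v (a + m)) - ∏ m ∈ range (l + 1), v (a + m) := by
  induction l generalizing a with
  | zero => simp
  | succ l ih =>
    rw [Nat.antidiagonal_succ, sum_cons, sum_map]
    simp only [Function.Embedding.prodMap, Function.Embedding.coeFn_mk, Prod.map,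
      Function.Embedding.refl_apply, Nat.succ_eq_add_one]
    have h : ∀ q ∈ antidiagonal l, (∏ m ∈ range (q.1 + 1), v (a + m)) *
        (∏ m ∈ range q.2, (1 + v (a + (q.1 + 1) + 1 + m))) =
        v a * ((∏ m ∈ range q.1, v (a + 1 + m)) *
        (∏ m ∈ range q.2, (1 + v (a + 1 + q.1 + 1 + m)))) := by
      intro q _
      rw [prod_range_succ', mul_comm _ (v (a + 0)), mul_assoc]
      simp only [add_zero]
      congr 2
      · exact prod_congr rfl fun m _ => by congr 1; omega
      · exact prod_congr rfl fun m _ => by congr 2; omega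
    rw [sum_congr rfl h, ← mul_sum, ih (a + 1)]
    rw [prod_range_succ' _ (l + 1), prod_range_succ' _ (l + 1)]
    have h1 : ∀ m, v (a + (m + 1)) = v (a + 1 + m) := fun m => by congr 1; omega
    simp only [h1, add_zero, range_zero, prod_empty]
    ring

end Sums

/-- Iterating the reduction rule at `β = 1`. -/
lemma mul_prod_sub_prod {R : Type*} [CommRing R] [NoZeroDivisors R] {u : ℕ × ℕ → R}
    (h0 : ∀ i j, i < j → u (i, j) ≠ 0)
    (hu : ∀ i j k, i < j → j < k →
      u (i, j) * u (j, k) = u (i, k) * (u (i, j) + u (j, k) + 1)) (a l : ℕ) :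
    u (a, a + (l + 1)) * (∏ m ∈ range (l + 1), (1 + u (a + m, a + m + 1))
        - ∏ m ∈ range (l + 1), u (a + m, a + m + 1)) =
      ∏ m ∈ range (l + 1), u (a + m, a + m + 1) := by
  induction l with
  | zero => simp
  | succ l ih =>
    have h := hu a (a + (l + 1)) (a + (l + 1) + 1) (by omega) (by omega)
    rw [prod_range_succ _ (l + 1), prod_range_succ _ (l + 1)]
    -- After multiplication by `s = u (a, a + (l + 1))`, `ih` turns `s ∏ (1 + u)` into `(1 + s) ∏
    -- u`. With `w` the last weight, the bracket becomes `(1 + s + w) ∏ u`, the sum in the reduction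
    -- rule.
    refine mul_left_cancel₀ (h0 a (a + (l + 1)) (by omega)) ?_
    rw [← add_assoc a (l + 1) 1]
    linear_combination
      (u (a, a + (l + 1) + 1) * (1 + u (a + (l + 1), a + (l + 1) + 1))) * ih
        - (∏ m ∈ range (l + 1), u (a + m, a + m + 1)) * h

/-- The canonical reduction of the path: if the weights satisfy the reduction rule at `β = 1`, then
the weight of the path is the sum of the weights of the noncrossing alternating families that
contain the longest pair. -/
theorem fullSum_eq_prod {R : Type*} [CommRing R] [NoZeroDivisors R] {u : ℕ × ℕ → R}
    (h0 : ∀ i j, i < j → u (i, j) ≠ 0)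
    (hu : ∀ i j k, i < j → j < k →
      u (i, j) * u (j, k) = u (i, k) * (u (i, j) + u (j, k) + 1)) (l a : ℕ) :
    fullSum' u a l = ∏ m ∈ range l, u (a + m, a + m + 1) ∧
      familySum u a l = ∏ m ∈ range l, (1 + u (a + m, a + m + 1)) := by
  induction l using Nat.strong_induction_on generalizing a with
  | _ l ih =>
    rcases l with _ | l
    · simp [fullSum', familySum_zero]
    · have hp : properSum u a (l + 1) = ∏ m ∈ range (l + 1), (1 + u (a + m, a + m + 1))
          - ∏ m ∈ range (l + 1), u (a + m, a + m + 1) := by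
        rw [properSum_succ, ← sum_antidiagonal_prod (fun m => u (m, m + 1))]
        refine sum_congr rfl fun q hq => ?_
        rw [HasAntidiagonal.mem_antidiagonal] at hq
        rw [(ih q.1 (by omega) a).1, (ih q.2 (by omega) (a + q.1 + 1)).2]
      have hf : fullSum u a (l + 1) = ∏ m ∈ range (l + 1), u (a + m, a + m + 1) := by
        rw [fullSum_eq_mul u (Nat.succ_pos l), hp, mul_prod_sub_prod h0 hu]
      refine ⟨by rw [fullSum', if_neg (Nat.succ_ne_zero l), hf], ?_⟩
      rw [familySum_eq_add, hf, hp]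
      ring

/-! ### The Kirkman–Cayley formula -/

section Constant

variable {R : Type*} [CommRing R] (z : R)

/-- Constant weights are translation invariant, so the shifted sums in `properSum_succ` become a
genuine convolution. -/
lemma sums_const_eq (l a : ℕ) :
    fullSum' (fun _ => z) a l = fullSum' (fun _ => z) 0 l ∧
      familySum (fun _ => z) a l = familySum (fun _ => z) 0 l := by
  induction l using Nat.strong_induction_on generalizing a with
  | _ l ih =>
    rcases l with _ | l
    · simp [fullSum', familySum_zero]
    · have hp : properSum (fun _ => z) a (l + 1) = properSum (fun _ => z) 0 (l + 1) := by
        rw [properSum_succ, properSum_succ]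
        refine sum_congr rfl fun q hq => ?_
        rw [HasAntidiagonal.mem_antidiagonal] at hq
        rw [(ih q.1 (by omega) a).1, (ih q.2 (by omega) (a + q.1 + 1)).2,
          (ih q.2 (by omega) (0 + q.1 + 1)).2]
      have hf : fullSum (fun _ => z) a (l + 1) = fullSum (fun _ => z) 0 (l + 1) := by
        rw [fullSum_eq_mul _ (Nat.succ_pos l), fullSum_eq_mul _ (Nat.succ_pos l), hp]
      refine ⟨by simp only [fullSum', hf], ?_⟩
      rw [familySum_eq_add, familySum_eq_add, hf, hp]

/-- The generating function of the sums over proper families, weighted by the number of pairs. -/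
noncomputable def properSeries : PowerSeries R :=
  PowerSeries.mk fun l => properSum (fun _ => z) 0 (l + 1)

/-- The two factors are the generating functions of `fullSum'` and `familySum`: the longest pair
contributes `z`, or optionally `1 + z`. Their product is the convolution `properSum_succ`. -/
lemma properSeries_eq :
    properSeries z = (1 + PowerSeries.C z * (PowerSeries.X * properSeries z)) *
      (1 + PowerSeries.C (1 + z) * (PowerSeries.X * properSeries z)) := by
  have h1 : (1 + PowerSeries.C z * (PowerSeries.X * properSeries z)) =
      PowerSeries.mk fun l => fullSum' (fun _ => z) 0 l := by
    ext l
    rcases l with _ | l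
    · simp [fullSum']
    · rw [map_add, PowerSeries.coeff_C_mul, PowerSeries.coeff_succ_X_mul, PowerSeries.coeff_one]
      simp [properSeries, fullSum', fullSum_eq_mul _ (Nat.succ_pos l)]
  have h2 : (1 + PowerSeries.C (1 + z) * (PowerSeries.X * properSeries z)) =
      PowerSeries.mk fun l => familySum (fun _ => z) 0 l := by
    ext l
    rcases l with _ | l
    · simp [familySum_zero]
    · rw [map_add, PowerSeries.coeff_C_mul, PowerSeries.coeff_succ_X_mul, PowerSeries.coeff_one]
      simp only [properSeries, PowerSeries.coeff_mk, familySum_eq_add,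
        fullSum_eq_mul _ (Nat.succ_pos l), Nat.succ_ne_zero, if_false]
      ring
  rw [h1, h2]
  ext l
  rw [PowerSeries.coeff_mul, properSeries, PowerSeries.coeff_mk, properSum_succ]
  refine sum_congr rfl fun q _ => ?_
  rw [PowerSeries.coeff_mk, PowerSeries.coeff_mk, (sums_const_eq z q.2 (0 + q.1 + 1)).2]

end Constant

-- The generating function is quadratic over the polynomials, so the square root `W` of its
-- discriminant satisfies a first-order linear differential equation. Comparing coefficients there
-- gives the recurrence.
open Polynomial in
lemma properSum_recurrence (l : ℕ) :
    ((l : ℚ[X]) + 4) * properSum (fun _ => (X : ℚ[X])) 0 (l + 3) =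
      (2 * (l : ℚ[X]) + 5) * ((1 + 2 * X) * properSum (fun _ => (X : ℚ[X])) 0 (l + 2))
        - ((l : ℚ[X]) + 1) * properSum (fun _ => (X : ℚ[X])) 0 (l + 1) := by
  set z : ℚ[X] := X
  set F := properSeries z
  have hF : F = (1 + PowerSeries.C z * (PowerSeries.X * F)) *
      (1 + PowerSeries.C (1 + z) * (PowerSeries.X * F)) := properSeries_eq z
  have hc : ∀ m, properSum (fun _ => z) 0 (m + 1) = PowerSeries.coeff m F :=
    fun m => (PowerSeries.coeff_mk m
      (fun l => properSum (fun _ => z) 0 (l + 1))).symm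
  rw [hc l, hc (l + 1), hc (l + 2)]
  set a : ℚ[X] := 1 + 2 * z with ha
  -- Up to sign, the derivative of the quadratic polynomial at its root `F`. Its square is the
  -- discriminant, which simplifies because `a ^ 2 - 4 z (1 + z) = 1`.
  set W : PowerSeries ℚ[X] := 1 - PowerSeries.C a * PowerSeries.X
    - PowerSeries.C (2 * z * (1 + z)) * (PowerSeries.X * (PowerSeries.X * F)) with hW
  have hW2 : W ^ 2 = 1 - 2 * PowerSeries.C a * PowerSeries.X + PowerSeries.X ^ 2 := by
    rw [hW, ha]
    simp only [map_add, map_mul, map_one, map_ofNat] at hF ⊢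
    linear_combination (-4 * PowerSeries.C z * (1 + PowerSeries.C z) * PowerSeries.X ^ 2) * hF
  have hd : W * PowerSeries.derivative ℚ[X] W = PowerSeries.X - PowerSeries.C a := by
    have h2 : (2 : PowerSeries ℚ[X]) ≠ 0 := by
      rw [← map_ofNat (PowerSeries.C (R := ℚ[X])) 2]
      exact (map_ne_zero_iff _ PowerSeries.C_injective).2 two_ne_zero
    have hWW : W * W = 1 - PowerSeries.C (2 * a) * PowerSeries.X
        + PowerSeries.X * PowerSeries.X := by
      rw [← sq, hW2, map_mul, map_ofNat]
      ring
    have h := congrArg (PowerSeries.derivative ℚ[X]) hWW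
    simp only [map_add, map_sub, Derivation.leibniz, smul_eq_mul, PowerSeries.derivative_C,
      PowerSeries.derivative_X, Derivation.map_one_eq_zero] at h
    rw [map_mul, map_ofNat] at h
    refine mul_left_cancel₀ h2 ?_
    linear_combination h
  have hode : PowerSeries.derivative ℚ[X] W
      - PowerSeries.C (2 * a) * (PowerSeries.X * PowerSeries.derivative ℚ[X] W)
      + PowerSeries.X * (PowerSeries.X * PowerSeries.derivative ℚ[X] W)
      = PowerSeries.X * W - PowerSeries.C a * W := by
    simp only [map_mul, map_ofNat]
    linear_combination W * hd - PowerSeries.derivative ℚ[X] W * hW2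
  have hWc : ∀ m, PowerSeries.coeff (m + 2) W = - (2 * z * (1 + z)) * PowerSeries.coeff m F := by
    intro m
    rw [hW, map_sub, map_sub, PowerSeries.coeff_C_mul, PowerSeries.coeff_C_mul,
      PowerSeries.coeff_succ_X_mul, PowerSeries.coeff_succ_X_mul, PowerSeries.coeff_one,
      PowerSeries.coeff_X]
    simp
  have h := congrArg (PowerSeries.coeff (l + 3)) hode
  simp only [map_add, map_sub, PowerSeries.coeff_C_mul, PowerSeries.coeff_succ_X_mul,
    PowerSeries.coeff_derivative, hWc] at h
  have hz : 2 * z * (1 + z) ≠ 0 := by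
    refine mul_ne_zero (mul_ne_zero two_ne_zero X_ne_zero) ?_
    have := X_add_C_ne_zero (1 : ℚ)
    rwa [map_one, add_comm] at this
  refine mul_left_cancel₀ hz ?_
  push_cast at h
  linear_combination -h

/-! ### The Kirkman–Cayley numbers satisfy the same recurrence -/

/-- The right hand side of the Kirkman–Cayley formula for the `(l + 3)`-gon. -/
def kirkmanCayley (l k : ℕ) : ℚ :=
  (Nat.choose (l + 1 + (k + 1)) (l + 1) : ℚ) * (Nat.choose l k : ℚ) / ((l : ℚ) + 2)

lemma kirkmanCayley_zero (l : ℕ) : kirkmanCayley l 0 = 1 := by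
  have h : (l + 1 + (0 + 1)).choose (l + 1) = l + 2 := by
    rw [zero_add, Nat.choose_succ_self_right]
  rw [kirkmanCayley, h, Nat.choose_zero_right]
  push_cast
  field_simp

lemma kirkmanCayley_eq_zero {l k : ℕ} (h : l < k) : kirkmanCayley l k = 0 := by
  simp [kirkmanCayley, Nat.choose_eq_zero_of_lt h]

lemma kirkmanCayley_add (k j : ℕ) :
    kirkmanCayley (k + j) k = ((2 * k + j + 2).factorial : ℚ) /
      ((k + j + 1).factorial * (k + 1).factorial) * ((k + j).factorial /
        (k.factorial * j.factorial)) / (k + j + 2) := by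
  rw [kirkmanCayley, Nat.cast_add_choose, Nat.cast_add_choose]
  have : k + j + 1 + (k + 1) = 2 * k + j + 2 := by ring
  rw [this]
  push_cast
  rfl

lemma kirkmanCayley_recurrence (l k : ℕ) :
    ((l : ℚ) + 4) * kirkmanCayley (l + 2) (k + 1) =
      (2 * l + 5) * (kirkmanCayley (l + 1) (k + 1) + 2 * kirkmanCayley (l + 1) k)
        - (l + 1) * kirkmanCayley l (k + 1) := by
  have hk : ((k + 1).factorial : ℚ) ≠ 0 := by positivity
  -- The factorial form needs `k ≤ l`. The cases where some binomials vanish, including the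
  -- boundaries `k = l + 1` and `k = l`, are separated from the generic one.
  rcases Nat.lt_or_ge l (k + 1) with h | h
  · rw [kirkmanCayley_eq_zero h]
    rcases Nat.lt_or_ge l k with h' | h'
    · rw [kirkmanCayley_eq_zero (by omega : l + 1 < k + 1)]
      rcases Nat.lt_or_ge (l + 1) k with h'' | h''
      · rw [kirkmanCayley_eq_zero (by omega : l + 2 < k + 1), kirkmanCayley_eq_zero h'']
        simp
      · obtain rfl : k = l + 1 := by omega
        have h1 := kirkmanCayley_add (l + 2) 0
        have h2 := kirkmanCayley_add (l + 1) 0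
        simp only [add_zero] at h1 h2
        rw [h1, h2]
        have e1 : 2 * (l + 2) + 2 = 2 * (l + 1) + 2 + 1 + 1 := by ring
        rw [e1]
        simp only [Nat.factorial_succ]
        push_cast
        field_simp
        ring
    · obtain rfl : l = k := by omega
      have h1 := kirkmanCayley_add (l + 1) 1
      have h2 := kirkmanCayley_add (l + 1) 0
      have h3 := kirkmanCayley_add l 1
      simp only [add_zero] at h1 h2 h3
      rw [h1, h2, h3]
      have e1 : 2 * (l + 1) + 1 + 2 = 2 * l + 1 + 2 + 1 + 1 := by ring
      have e2 : 2 * (l + 1) + 2 = 2 * l + 1 + 2 + 1 := by ring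
      rw [e1, e2]
      simp only [Nat.factorial_succ]
      push_cast
      field_simp
      ring
  · obtain ⟨j, rfl⟩ := Nat.exists_eq_add_of_le h
    have h1 := kirkmanCayley_add (k + 1) (j + 2)
    have h2 := kirkmanCayley_add (k + 1) (j + 1)
    have h3 := kirkmanCayley_add k (j + 2)
    have h4 := kirkmanCayley_add (k + 1) j
    rw [show k + (j + 2) = k + 1 + j + 1 by ring] at h3
    rw [show k + 1 + (j + 2) = k + 1 + j + 2 by ring] at h1
    rw [show k + 1 + (j + 1) = k + 1 + j + 1 by ring] at h2
    rw [h1, h2, h3, h4]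
    rw [show 2 * (k + 1) + (j + 2) + 2 = 2 * k + j + 4 + 1 + 1 by ring,
      show 2 * (k + 1) + (j + 1) + 2 = 2 * k + j + 4 + 1 by ring,
      show 2 * (k + 1) + j + 2 = 2 * k + j + 4 by ring,
      show 2 * k + (j + 2) + 2 = 2 * k + j + 4 by ring,
      show k + 1 + j = k + j + 1 by ring]
    simp only [Nat.factorial_succ]
    push_cast
    field_simp
    ring

-- Both sides obey the same three-term recurrence in `l`; the initial polynomials are `1` and `1 + 2
-- X`.
open Polynomial in
theorem coeff_properSum (l k : ℕ) :
    (properSum (fun _ => (X : ℚ[X])) 0 (l + 1)).coeff k = kirkmanCayley l k := by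
  induction l using Nat.strong_induction_on generalizing k with
  | _ l ih =>
    rcases l with _ | _ | l
    · have : properSum (fun _ => (X : ℚ[X])) 0 (0 + 1) = 1 := by
        rw [properSum_succ]
        simp [fullSum', familySum_zero]
      rw [this, coeff_one]
      rcases k with _ | k
      · simp [kirkmanCayley_zero]
      · simp [kirkmanCayley_eq_zero]
    · have : properSum (fun _ => (X : ℚ[X])) 0 (0 + 1 + 1) = 1 + C 2 * X := by
        have h1 : ∀ a, properSum (fun _ => (X : ℚ[X])) a (0 + 1) = 1 := fun a => by
          rw [properSum_succ]
          simp [fullSum', familySum_zero]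
        have h2 : ∀ a, fullSum (fun _ => (X : ℚ[X])) a 1 = X := fun a => by
          rw [fullSum_eq_mul _ one_pos, ← zero_add 1, h1 a, mul_one]
        have h3 : ∀ a, familySum (fun _ => (X : ℚ[X])) a 1 = X + 1 := fun a => by
          rw [familySum_eq_add, h2, ← zero_add 1, h1 a]
        rw [properSum_succ, Nat.antidiagonal_succ, sum_cons, sum_map]
        simp [fullSum', familySum_zero, h2, h3, map_ofNat]
        ring
      rw [this]
      rcases k with _ | _ | k
      · simp [kirkmanCayley_zero]
      · simp [kirkmanCayley, coeff_one]
        norm_num [Nat.choose]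
      · rw [kirkmanCayley_eq_zero (by omega)]
        simp [coeff_one]
    · have h := congrArg (fun p => coeff p k) (properSum_recurrence l)
      have e1 : ((l : ℚ[X]) + 4) = C ((l : ℚ) + 4) := by simp [map_ofNat]
      have e2 : (2 * (l : ℚ[X]) + 5) = C (2 * (l : ℚ) + 5) := by simp [map_ofNat]
      have e3 : ((l : ℚ[X]) + 1) = C ((l : ℚ) + 1) := by simp
      have e4 : ((1 : ℚ[X]) + 2 * X) = 1 + C 2 * X := by simp [map_ofNat]
      rw [e1, e2, e3, e4] at h
      simp only [coeff_sub, coeff_C_mul, add_mul (1 : ℚ[X]), one_mul, coeff_add, mul_assoc] at h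
      rw [ih l (by omega), ih (l + 1) (by omega)] at h
      have hl : ((l : ℚ) + 4) ≠ 0 := by positivity
      refine mul_left_cancel₀ hl (h.trans ?_)
      rcases k with _ | k
      · simp only [coeff_X_mul_zero, kirkmanCayley_zero]
        ring
      · rw [coeff_X_mul, ih (l + 1) (by omega), kirkmanCayley_recurrence]

/-! ### Dissections and forests as noncrossing alternating families -/

/-- The number of families in `[0, n]` of `k + 1` pairs that contain `(0, n)`. -/
def fullFamilyCount (n k : ℕ) : ℕ := ((fullFamilies 0 n).filter fun G => G.card = k + 1).card

/-- Send a diagonal `(a, b)` to `(a, b - 1)`. The condition `a < a' < b < b'` becomes `a < a' ≤ b -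
1 < b' - 1`, which is exactly what `Compatible` forbids. The excluded side `(0, n + 1)` would go to
`(0, n)`, the pair that is adjoined. -/
lemma ncard_dissections {n : ℕ} (hn : 1 ≤ n) (k : ℕ) :
    (dissections n k).ncard = fullFamilyCount n k := by
  have hinj : ∀ D ∈ dissections n k, ∀ p ∈ D, ∀ q ∈ D,
      ((p.1.val, p.2.val - 1) : ℕ × ℕ) = (q.1.val, q.2.val - 1) → p = q := by
    intro D hD p hp q hq h
    have h1 := (hD.1 p hp).1
    have h2 := (hD.1 q hq).1
    rw [Prod.mk.injEq] at h
    ext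
    · exact h.1
    · omega
  have hnot : ∀ D ∈ dissections n k,
      (0, n) ∉ D.image fun p => ((p.1.val, p.2.val - 1) : ℕ × ℕ) := by
    intro D hD hmem
    obtain ⟨p, hp, h⟩ := mem_image.1 hmem
    rw [Prod.mk.injEq] at h
    have h1 := hD.1 p hp
    exact h1.2 ⟨h.1, by have := h1.1; omega⟩
  rw [fullFamilyCount, ← Set.ncard_coe_finset]
  refine Set.ncard_congr
    (fun D _ => insert (0, n) (D.image fun p => ((p.1.val, p.2.val - 1) : ℕ × ℕ))) ?_ ?_ ?_
  · intro D hD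
    have hmem : ∀ e ∈ insert (0, n) (D.image fun p => ((p.1.val, p.2.val - 1) : ℕ × ℕ)),
        e = (0, n) ∨ ∃ p ∈ D, e = (p.1.val, p.2.val - 1) ∧ p.1.val + 1 < p.2.val := by
      intro e he
      rcases mem_insert.1 he with he | he
      · exact Or.inl he
      · obtain ⟨p, hp, rfl⟩ := mem_image.1 he
        exact Or.inr ⟨p, hp, rfl, (hD.1 p hp).1⟩
    rw [mem_coe, mem_filter, mem_fullFamilies, zero_add]
    refine ⟨⟨?_, ?_, mem_insert_self _ _⟩, ?_⟩
    · intro e he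
      rw [mem_pairsIn]
      rcases hmem e he with rfl | ⟨p, hp, rfl, h⟩
      · dsimp only; omega
      · have := p.2.isLt
        dsimp only; omega
    · intro e he f hf
      rcases hmem e he with rfl | ⟨p, hp, rfl, h⟩ <;> rcases hmem f hf with rfl | ⟨q, hq, rfl, h'⟩
      · dsimp only; omega
      · have := q.2.isLt
        dsimp only; omega
      · dsimp only; omega
      · have h3 := hD.2.1 p hp q hq
        simp only [Crosses, Fin.lt_def] at h3
        dsimp only
        omega
    · rw [card_insert_of_notMem (hnot D hD), card_image_of_injOn (fun p hp q hq => hinj D hD p hp q hq),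
        hD.2.2]
  · intro D D' hD hD' h
    have h' : (D.image fun p => ((p.1.val, p.2.val - 1) : ℕ × ℕ)) =
        D'.image fun p => ((p.1.val, p.2.val - 1) : ℕ × ℕ) := by
      have := congrArg (fun s => s.erase (0, n)) h
      simpa only [erase_insert (hnot D hD), erase_insert (hnot D' hD')] using this
    have key : ∀ D ∈ dissections n k, ∀ p : Fin (n + 2) × Fin (n + 2),
        p ∈ D ↔ p.1.val + 1 < p.2.val ∧
          ((p.1.val, p.2.val - 1) : ℕ × ℕ) ∈ D.image fun p => (p.1.val, p.2.val - 1) := by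
      intro D hD p
      refine ⟨fun hp => ⟨(hD.1 p hp).1, mem_image_of_mem _ hp⟩, fun ⟨h1, h2⟩ => ?_⟩
      obtain ⟨q, hq, hqp⟩ := mem_image.1 h2
      have h3 := (hD.1 q hq).1
      rw [Prod.mk.injEq] at hqp
      have : q = p := by
        ext
        · exact hqp.1
        · omega
      exact this ▸ hq
    ext p
    rw [key D hD, key D' hD', h']
  · intro G hG
    rw [mem_coe, mem_filter, mem_fullFamilies, zero_add] at hG
    obtain ⟨⟨hs, hc, hf⟩, hcard⟩ := hG
    set D : Finset (Fin (n + 2) × Fin (n + 2)) := univ.filter fun p =>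
      p.1.val + 1 < p.2.val ∧ ((p.1.val, p.2.val - 1) : ℕ × ℕ) ∈ G.erase (0, n) with hDdef
    have himg : (D.image fun p => ((p.1.val, p.2.val - 1) : ℕ × ℕ)) = G.erase (0, n) := by
      ext e
      rw [mem_image]
      constructor
      · rintro ⟨p, hp, rfl⟩
        exact (mem_filter.1 hp).2.2
      · intro he
        have h1 := mem_pairsIn.1 (hs (mem_of_mem_erase he))
        refine ⟨(⟨e.1, by omega⟩, ⟨e.2 + 1, by omega⟩), ?_, ?_⟩
        · rw [hDdef, mem_filter]
          exact ⟨mem_univ _, by dsimp only; omega, by simpa using he⟩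
        · simp
    have hD : (∀ p ∈ D, IsDiagonal p) ∧ (∀ p ∈ D, ∀ q ∈ D, ¬ Crosses p q) := by
      constructor
      · intro p hp
        obtain ⟨-, h1, h2⟩ := mem_filter.1 hp
        refine ⟨h1, fun ⟨h3, h4⟩ => (mem_erase.1 h2).1 ?_⟩
        rw [Prod.mk.injEq]
        omega
      · intro p hp q hq
        obtain ⟨-, h1, h2⟩ := mem_filter.1 hp
        obtain ⟨-, h3, h4⟩ := mem_filter.1 hq
        have h5 := hc _ (mem_of_mem_erase h2) _ (mem_of_mem_erase h4)
        have h6 := hc _ (mem_of_mem_erase h4) _ (mem_of_mem_erase h2)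
        simp only [Crosses, Fin.lt_def]
        dsimp only at h5 h6
        omega
    refine ⟨D, ⟨hD.1, hD.2, ?_⟩, ?_⟩
    · have : D.card = (D.image fun p => ((p.1.val, p.2.val - 1) : ℕ × ℕ)).card := by
        refine (card_image_of_injOn fun p hp q hq h => ?_).symm
        have h1 := (mem_filter.1 hp).2.1
        have h2 := (mem_filter.1 hq).2.1
        rw [Prod.mk.injEq] at h
        ext
        · exact h.1
        · omega
      rw [this, himg, card_erase_of_mem hf, hcard, Nat.add_sub_cancel]
    · rw [himg, insert_erase hf]

/-! ### Graphs as families, and acyclicity -/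

/-- An edge as a pair of natural numbers. -/
def edgeVal {n : ℕ} : Edge n ↪ ℕ × ℕ where
  toFun e := (e.1.1.val, e.1.2.val)
  inj' e f h := by
    rw [Prod.mk.injEq] at h
    exact Subtype.ext (Prod.ext (Fin.ext h.1) (Fin.ext h.2))

lemma edgeVal_lt {n : ℕ} (e : Edge n) : (edgeVal e).1 < (edgeVal e).2 := e.2

lemma edgeVal_le {n : ℕ} (e : Edge n) : (edgeVal e).2 ≤ n := Nat.lt_succ_iff.1 e.1.2.isLt

lemma exists_edgeVal_eq {n : ℕ} {e : ℕ × ℕ} (h1 : e.1 < e.2) (h2 : e.2 ≤ n) :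
    ∃ f : Edge n, edgeVal f = e :=
  ⟨⟨(⟨e.1, by omega⟩, ⟨e.2, by omega⟩), h1⟩, rfl⟩

/-- In `f.1 ≤ e.2`, strict inequality is a crossing and equality a failure of alternation. -/
lemma compatible_map_edgeVal {n : ℕ} (G : Graph n) :
    Compatible (G.map edgeVal) ↔ Graph.IsNoncrossing G ∧ Graph.IsAlternating G := by
  constructor
  · intro h
    refine ⟨fun i j k l hij hjk hkl ⟨h1, h2⟩ => ?_, fun i j k hij hjk ⟨h1, h2⟩ => ?_⟩
    · exact h _ (mem_map_of_mem _ h1) _ (mem_map_of_mem _ h2) ⟨hij, hjk.le, hkl⟩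
    · exact h _ (mem_map_of_mem _ h1) _ (mem_map_of_mem _ h2) ⟨hij, le_rfl, hjk⟩
  · rintro ⟨hnc, ha⟩ e he' f hf' ⟨h1, h2, h3⟩
    obtain ⟨⟨⟨i, k⟩, hik⟩, he, rfl⟩ := mem_map.1 he'
    obtain ⟨⟨⟨j, l⟩, hjl⟩, hf, rfl⟩ := mem_map.1 hf'
    rcases Nat.lt_or_eq_of_le h2 with h2 | h2
    · exact hnc i j k l h1 h2 h3 ⟨he, hf⟩
    · obtain rfl : j = k := Fin.ext h2
      exact ha i j l h1 h3 ⟨he, hf⟩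

/-- In a noncrossing alternating family, every pair is a bridge: there is a set of vertices that
separates its two ends and is not left by any other pair. -/
lemma exists_separating_set {G : Finset (ℕ × ℕ)} (hG : Compatible G) (hlt : ∀ e ∈ G, e.1 < e.2)
    {i j : ℕ} (hij : (i, j) ∈ G) :
    ∃ B : ℕ → Prop, B i ∧ ¬ B j ∧ ∀ e ∈ G, e ≠ (i, j) → (B e.1 ↔ B e.2) := by
  have hij' : i < j := hlt _ hij
  -- `m` is the farthest right neighbour of `i` before `j`, or `i` itself.
  obtain ⟨m, him, hmj, hm, hmax⟩ : ∃ m, i ≤ m ∧ m < j ∧ (m = i ∨ (i, m) ∈ G) ∧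
      ∀ b, b < j → (i, b) ∈ G → b ≤ m := by
    refine ⟨Nat.findGreatest (fun m => m = i ∨ (i, m) ∈ G) (j - 1), ?_, ?_, ?_, ?_⟩
    · exact Nat.le_findGreatest (by omega) (Or.inl rfl)
    · exact (Nat.findGreatest_le _).trans_lt (by omega)
    · exact Nat.findGreatest_spec (P := fun m => m = i ∨ (i, m) ∈ G) (m := i) (by omega)
        (Or.inl rfl)
    · exact fun b hb hib => Nat.le_findGreatest (by omega) (Or.inr hib)
  have hfirst : ∀ e ∈ G, e.1 = i → e.2 < j → e.2 ≤ m := fun e he h1 h2 =>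
    hmax e.2 h2 (by rw [← h1]; exact he)
  have hm' : ∀ e ∈ G, m = i ∨ (¬ (e.1 < i ∧ i ≤ e.2 ∧ e.2 < m) ∧
      ¬ (i < e.1 ∧ e.1 ≤ m ∧ m < e.2)) := fun e he =>
    hm.imp_right fun h => ⟨hG _ he _ h, hG _ h _ he⟩
  have hne : ∀ e : ℕ × ℕ, e ≠ (i, j) → ¬ (e.1 = i ∧ e.2 = j) := fun e he h =>
    he (Prod.ext h.1 h.2)
  -- A pair `(a, j)` with `a < i` rules out pairs from `i` to beyond `j`, so `[i, m]` is isolated.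
  -- Without such a pair, only `(i, j)` can enter `(m, j]`, and the complement of that interval is
  -- used.
  by_cases h : ∃ a, a < i ∧ (a, j) ∈ G
  · obtain ⟨a, hai, haj⟩ := h
    refine ⟨fun x => i ≤ x ∧ x ≤ m, ⟨le_rfl, him⟩, by omega, fun e he hn => ?_⟩
    have h1 := hG _ he _ hij
    have h2 := hG _ hij _ he
    have h3 := hG _ haj _ he
    have h4 := hG _ he _ haj
    have h5 := hm' e he
    have h6 := hfirst e he
    have h7 := hne e hn
    have h8 := hlt e he
    dsimp only at h1 h2 h3 h4
    omega
  · have h3 : ∀ e ∈ G, e.1 < i → e.2 ≠ j := fun e he h1 h2 =>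
      h ⟨e.1, h1, by rw [← h2]; exact he⟩
    refine ⟨fun x => x ≤ m ∨ j < x, Or.inl him, by omega, fun e he hn => ?_⟩
    have h1 := hG _ he _ hij
    have h2 := hG _ hij _ he
    have h3 := h3 e he
    have h5 := hm' e he
    have h6 := hfirst e he
    have h7 := hne e hn
    have h8 := hlt e he
    dsimp only at h1 h2
    omega

/-- Membership in the separating set is constant along walks that avoid the edge, so every edge is a
bridge. -/
lemma isForest_of_compatible {n : ℕ} {G : Graph n} (hG : Compatible (G.map edgeVal)) :
    Graph.IsForest G := by
  have hlt : ∀ e ∈ G.map edgeVal, e.1 < e.2 := by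
    intro e he
    obtain ⟨f, -, rfl⟩ := mem_map.1 he
    exact edgeVal_lt f
  rw [Graph.IsForest, SimpleGraph.isAcyclic_iff_forall_isBridge]
  intro s hs
  rw [Graph.toSimpleGraph, SimpleGraph.edgeSet_fromEdgeSet] at hs
  obtain ⟨⟨e, he, rfl⟩, -⟩ := hs
  obtain ⟨B, hi, hj, hB⟩ := exists_separating_set hG hlt (mem_map_of_mem edgeVal he)
  rw [SimpleGraph.isBridge_iff]
  rintro ⟨p⟩
  have key : ∀ a b : Fin (n + 1), ((Graph.toSimpleGraph G).deleteEdges {s(e.1.1, e.1.2)}).Walk a b →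
      (B a ↔ B b) := by
    intro a b p
    induction p with
    | nil => exact Iff.rfl
    | cons h p ih =>
      rename_i a b c
      refine Iff.trans ?_ ih
      rw [SimpleGraph.deleteEdges_adj, Graph.toSimpleGraph, SimpleGraph.fromEdgeSet_adj] at h
      obtain ⟨⟨⟨f, hf, hab⟩, -⟩, hn⟩ := h
      have hfe : edgeVal f ≠ edgeVal e := fun hfe => hn (by
        rw [hab, edgeVal.injective hfe]; rfl)
      have := hB _ (mem_map_of_mem edgeVal hf) hfe
      rcases Sym2.eq_iff.1 hab with ⟨rfl, rfl⟩ | ⟨rfl, rfl⟩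
      · exact this
      · exact this.symm
  exact hj ((key _ _ p).1 hi)

lemma ncard_noncrossingAlternatingForests (n k : ℕ) :
    (noncrossingAlternatingForests n (k + 1)).ncard = fullFamilyCount n k := by
  rw [fullFamilyCount, ← Set.ncard_coe_finset]
  refine Set.ncard_congr (fun G _ => G.map edgeVal) ?_ ?_ ?_
  · rintro G ⟨-, hnc, ha, hcard, e, he, he'⟩
    rw [mem_coe, mem_filter, mem_fullFamilies, zero_add, card_map]
    refine ⟨⟨?_, (compatible_map_edgeVal G).2 ⟨hnc, ha⟩, mem_map.2 ⟨e, he, ?_⟩⟩, hcard⟩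
    · intro f hf
      obtain ⟨f, -, rfl⟩ := mem_map.1 hf
      rw [mem_pairsIn, zero_add]
      exact ⟨Nat.zero_le _, edgeVal_lt f, edgeVal_le f⟩
    · change (e.1.1.val, e.1.2.val) = (0, n)
      rw [he']
      rfl
  · intro G H _ _ h
    exact map_injective _ h
  · intro G hG
    rw [mem_coe, mem_filter, mem_fullFamilies, zero_add] at hG
    obtain ⟨⟨hs, hc, hf⟩, hcard⟩ := hG
    have hmap : (univ.filter fun e : Edge n => edgeVal e ∈ G).map edgeVal = G := by
      ext e
      rw [mem_map]
      constructor
      · rintro ⟨f, hf, rfl⟩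
        exact (mem_filter.1 hf).2
      · intro he
        have h1 := mem_pairsIn.1 (hs he)
        obtain ⟨f, rfl⟩ := exists_edgeVal_eq (n := n) h1.2.1 (by omega)
        exact ⟨f, mem_filter.2 ⟨mem_univ _, he⟩, rfl⟩
    have hc' := hc
    rw [← hmap, compatible_map_edgeVal] at hc'
    refine ⟨_, ⟨isForest_of_compatible (by rwa [hmap]), hc'.1, hc'.2, ?_, ?_⟩, hmap⟩
    · rw [← card_map edgeVal, hmap, hcard]
    · have h1 := mem_pairsIn.1 (hs hf)
      obtain ⟨f, hfe⟩ := exists_edgeVal_eq (n := n) h1.2.1 (by omega)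
      refine ⟨f, mem_filter.2 ⟨mem_univ _, by rwa [hfe]⟩, ?_⟩
      have h2 : (f.1.1.val, f.1.2.val) = (0, n) := hfe
      rw [Prod.mk.injEq] at h2
      exact Prod.ext (Fin.ext h2.1) (Fin.ext h2.2)

open Polynomial in
lemma fullFamilyCount_eq {n : ℕ} (hn : 1 ≤ n) (k : ℕ) :
    (fullFamilyCount n k : ℚ) = kirkmanCayley (n - 1) k := by
  obtain ⟨l, rfl⟩ := Nat.exists_eq_add_of_le' hn
  have h : fullSum (fun _ => (X : ℚ[X])) 0 (l + 1) =
      X * properSum (fun _ => (X : ℚ[X])) 0 (l + 1) := fullSum_eq_mul _ (Nat.succ_pos l)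
  have h1 := congrArg (fun p => coeff p (k + 1)) h
  simp only [coeff_X_mul, coeff_properSum] at h1
  rw [Nat.add_sub_cancel, ← h1, fullSum, finsetSum_coeff, fullFamilyCount, card_filter]
  push_cast
  refine sum_congr rfl fun G _ => ?_
  rw [prod_const, coeff_X_pow]
  simp only [eq_comm]

/-! ### Power series in the simple roots -/

/-- The indicator function of `[i, j)`, the exponent of the root `e_i - e_j` in the simple roots. -/
noncomputable def intervalVec (e : ℕ × ℕ) : ℕ →₀ ℕ := ∑ m ∈ Ico e.1 e.2, Finsupp.single m 1

lemma intervalVec_apply (e : ℕ × ℕ) (m : ℕ) :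
    intervalVec e m = if e.1 ≤ m ∧ m < e.2 then 1 else 0 := by
  simp [intervalVec, Finsupp.finsetSum_apply, Finsupp.single_apply]

lemma intervalVec_add {i j k : ℕ} (hij : i < j) (hjk : j < k) :
    intervalVec (i, j) + intervalVec (j, k) = intervalVec (i, k) :=
  sum_Ico_consecutive _ hij.le hjk.le

lemma smul_intervalVec_injective {e : ℕ × ℕ} (he : e.1 < e.2) {c d : ℕ}
    (h : c • intervalVec e = d • intervalVec e) : c = d := by
  have := DFunLike.congr_fun h e.1
  simpa [intervalVec_apply, he] using this

section Series

variable (K : Type*) [CommRing K]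

open Classical in
/-- The series `∑_{c ≥ 1} y^{c (e_i - e_j)}`. -/
noncomputable def edgeSeries (e : ℕ × ℕ) : MvPowerSeries ℕ K :=
  fun p => if ∃ c : ℕ, c ≠ 0 ∧ p = c • intervalVec e then 1 else 0

lemma coeff_edgeSeries_smul {e : ℕ × ℕ} (he : e.1 < e.2) (c : ℕ) :
    MvPowerSeries.coeff (c • intervalVec e) (edgeSeries K e) = if c = 0 then 0 else 1 := by
  rw [MvPowerSeries.coeff_apply, edgeSeries]
  by_cases hc : c = 0
  · rw [if_neg, if_pos hc]
    rintro ⟨d, hd, h⟩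
    exact hd ((smul_intervalVec_injective he h).symm.trans hc)
  · rw [if_pos ⟨c, hc, rfl⟩, if_neg hc]

lemma coeff_edgeSeries_eq_zero {e : ℕ × ℕ} {p : ℕ →₀ ℕ} (h : ∀ c : ℕ, p ≠ c • intervalVec e) :
    MvPowerSeries.coeff p (edgeSeries K e) = 0 := by
  rw [MvPowerSeries.coeff_apply, edgeSeries, if_neg]
  rintro ⟨c, -, hc⟩
  exact h c hc

/-- Shifting the geometric series by one root cancels all but its first term; this is `Y / (1 - Y)`
without division. -/
lemma one_sub_mul_edgeSeries {e : ℕ × ℕ} (he : e.1 < e.2) :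
    (1 - MvPowerSeries.monomial (intervalVec e) (1 : K)) * edgeSeries K e =
      MvPowerSeries.monomial (intervalVec e) 1 := by
  ext p
  rw [sub_mul, one_mul, map_sub, MvPowerSeries.coeff_monomial_mul, MvPowerSeries.coeff_monomial,
    one_mul]
  by_cases hp : ∃ c : ℕ, p = c • intervalVec e
  · obtain ⟨c, rfl⟩ := hp
    have hI : c • intervalVec e = intervalVec e ↔ c = 1 :=
      ⟨fun h => smul_intervalVec_injective he (h.trans (one_smul ℕ _).symm),
        fun h => by rw [h, one_smul]⟩
    rw [coeff_edgeSeries_smul K he]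
    rcases c with _ | c
    · have hle : ¬ intervalVec e ≤ 0 • intervalVec e := fun h => by
        have := h e.1
        simp [intervalVec_apply, he] at this
      rw [if_pos rfl, if_neg hle, if_neg (by rw [hI]; omega), sub_zero]
    · have hle : intervalVec e ≤ (c + 1) • intervalVec e := by
        rw [add_smul, one_smul]
        exact le_add_self
      have hsub : (c + 1) • intervalVec e - intervalVec e = c • intervalVec e := by
        rw [add_smul, one_smul, add_tsub_cancel_right]
      rw [if_neg (Nat.succ_ne_zero c), if_pos hle, hsub, coeff_edgeSeries_smul K he]
      rcases c with _ | c
      · rw [if_pos rfl, if_pos (hI.2 rfl), sub_zero]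
      · rw [if_neg (Nat.succ_ne_zero c), if_neg (by rw [hI]; omega), sub_self]
  · push Not at hp
    have hne : p ≠ intervalVec e := fun h => hp 1 (by rw [h, one_smul])
    rw [coeff_edgeSeries_eq_zero K hp, if_neg hne]
    split_ifs with h
    · rw [coeff_edgeSeries_eq_zero, sub_zero]
      intro c hc
      refine hp (c + 1) ?_
      rw [add_smul, one_smul, ← hc, tsub_add_cancel_of_le h]
    · simp

variable {K} in
lemma edgeSeries_ne_zero [Nontrivial K] {e : ℕ × ℕ} (he : e.1 < e.2) : edgeSeries K e ≠ 0 := by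
  intro h
  have := coeff_edgeSeries_smul K he 1
  simp [h] at this

/-- With `A = Ya / (1 - Ya)`, `B = Yb / (1 - Yb)` and `C = YaYb / (1 - YaYb)`, one has `A + B + 1 =
(1 - YaYb) / ((1 - Ya)(1 - Yb))`. Clearing the denominators gives the rule. -/
lemma edgeSeries_mul [NoZeroDivisors K] [Nontrivial K] {i j k : ℕ} (hij : i < j) (hjk : j < k) :
    edgeSeries K (i, j) * edgeSeries K (j, k) =
      edgeSeries K (i, k) * (edgeSeries K (i, j) + edgeSeries K (j, k) + 1) := by
  have hne : ∀ e : ℕ × ℕ, e.1 < e.2 → 1 - MvPowerSeries.monomial (intervalVec e) (1 : K) ≠ 0 := by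
    intro e he h
    have h0 := one_sub_mul_edgeSeries K he
    rw [h, zero_mul] at h0
    have := congrArg (MvPowerSeries.coeff (intervalVec e)) h0
    rw [MvPowerSeries.coeff_monomial_same] at this
    simp at this
  have hA := one_sub_mul_edgeSeries K (e := (i, j)) hij
  have hB := one_sub_mul_edgeSeries K (e := (j, k)) hjk
  have hC := one_sub_mul_edgeSeries K (e := (i, k)) (hij.trans hjk)
  have hY : MvPowerSeries.monomial (intervalVec (i, k)) (1 : K) =
      MvPowerSeries.monomial (intervalVec (i, j)) 1 *
        MvPowerSeries.monomial (intervalVec (j, k)) 1 := by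
    rw [MvPowerSeries.monomial_mul_monomial, intervalVec_add hij hjk, one_mul]
  have h1 := hne (i, j) hij
  have h2 := hne (j, k) hjk
  have h3 := hne (i, k) (hij.trans hjk)
  rw [hY] at hC h3
  refine mul_left_cancel₀ (mul_ne_zero (mul_ne_zero h1 h2) h3) ?_
  generalize MvPowerSeries.monomial (intervalVec (i, j)) (1 : K) = Ya at *
  generalize MvPowerSeries.monomial (intervalVec (j, k)) (1 : K) = Yb at *
  generalize edgeSeries K (i, j) = A at *
  generalize edgeSeries K (j, k) = B at *
  generalize edgeSeries K (i, k) = C at *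
  linear_combination (1 - Ya * Yb) * ((1 - Yb) * B * hA + Ya * hB)
    - (1 - Ya) * (1 - Yb) * (A + B + 1) * hC - Ya * Yb * ((1 - Yb) * hA + (1 - Ya) * hB)

/-! ### Collecting series by height -/

/-- The sum of the positive coordinates of the lattice point with coordinates `p` in the simple
roots. -/
def height (n : ℕ) (p : ℕ →₀ ℕ) : ℕ := p 0 + ∑ m ∈ range n, (p (m + 1) - p m)

/-- Telescoping the increments bounds each coordinate by the height, so each level is finite. -/
lemma apply_le_height {n m : ℕ} (hm : m ≤ n) (p : ℕ →₀ ℕ) : p m ≤ height n p := by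
  have h : ∀ m, p m ≤ p 0 + ∑ m ∈ range m, (p (m + 1) - p m) := by
    intro m
    induction m with
    | zero => simp
    | succ m ih => rw [sum_range_succ]; omega
  refine (h m).trans (Nat.add_le_add_left ?_ _)
  exact sum_le_sum_of_subset (range_subset_range.2 hm)

/-- The lattice points of height `N` in the cone of the first `n` simple roots. -/
noncomputable def level (n N : ℕ) : Finset (ℕ →₀ ℕ) :=
  (Icc 0 (∑ m ∈ range n, Finsupp.single m N)).filter fun p => height n p = N

lemma mem_level {n N : ℕ} {p : ℕ →₀ ℕ} :
    p ∈ level n N ↔ (∀ m, n ≤ m → p m = 0) ∧ height n p = N := by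
  have happ : ∀ m, (∑ m ∈ range n, Finsupp.single m N : ℕ →₀ ℕ) m = if m < n then N else 0 := by
    intro m
    simp [Finsupp.finsetSum_apply, Finsupp.single_apply]
  rw [level, mem_filter, mem_Icc, and_congr_left_iff]
  intro hN
  constructor
  · intro h m hm
    have := h.2 m
    rw [happ, if_neg (by omega)] at this
    omega
  · refine fun h => ⟨bot_le, fun m => ?_⟩
    rw [happ]
    split_ifs with hm
    · rw [← hN]; exact apply_le_height hm.le p
    · rw [h m (by omega)]

/-- Collect the coefficients of a series by the height of their exponents. -/
noncomputable def collect (n : ℕ) : MvPowerSeries ℕ K →ₗ[K] PowerSeries K where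
  toFun F := PowerSeries.mk fun N => ∑ p ∈ level n N, MvPowerSeries.coeff p F
  map_add' F G := by
    ext N
    simp [sum_add_distrib]
  map_smul' c F := by
    ext N
    simp [mul_sum]

variable {K}

lemma coeff_collect (n N : ℕ) (F : MvPowerSeries ℕ K) :
    PowerSeries.coeff N (collect K n F) = ∑ p ∈ level n N, MvPowerSeries.coeff p F :=
  PowerSeries.coeff_mk N fun N => ∑ p ∈ level n N, MvPowerSeries.coeff p F

lemma collect_monomial {n : ℕ} {p : ℕ →₀ ℕ} (hp : ∀ m, n ≤ m → p m = 0) :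
    collect K n (MvPowerSeries.monomial p 1) = PowerSeries.X ^ height n p := by
  ext N
  rw [coeff_collect, PowerSeries.coeff_X_pow]
  simp only [MvPowerSeries.coeff_monomial, sum_ite_eq', mem_level]
  exact if_congr ⟨fun h => (mem_level.1 h).2.symm, fun h => mem_level.2 ⟨hp, h.symm⟩⟩ rfl rfl

/-- The lattice points in the cone of the first `n` simple roots whose positive coordinates are at
positions in `A`, and the negative ones at positions outside `A`. -/
def signCone (n : ℕ) (A : ℕ → Prop) : AddSubmonoid (ℕ →₀ ℕ) where
  carrier := {p | (∀ m, n ≤ m → p m = 0) ∧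
    ∀ m, (A (m + 1) → p m ≤ p (m + 1)) ∧ (¬ A (m + 1) → p (m + 1) ≤ p m)}
  zero_mem' := by simp
  add_mem' := by
    rintro p q ⟨hp, hp'⟩ ⟨hq, hq'⟩
    refine ⟨fun m hm => by simp [hp m hm, hq m hm], fun m => ?_⟩
    have h1 := hp' m
    have h2 := hq' m
    simp only [Finsupp.add_apply]
    exact ⟨fun h => add_le_add (h1.1 h) (h2.1 h), fun h => add_le_add (h1.2 h) (h2.2 h)⟩

/-- Truncated subtraction is additive when corresponding increments of `p` and `q` have the same
sign. -/
lemma height_add {n : ℕ} {A : ℕ → Prop} {p q : ℕ →₀ ℕ} (hp : p ∈ signCone n A)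
    (hq : q ∈ signCone n A) : height n (p + q) = height n p + height n q := by
  have : ∀ m, (p + q) (m + 1) - (p + q) m = (p (m + 1) - p m) + (q (m + 1) - q m) := by
    intro m
    have h1 := hp.2 m
    have h2 := hq.2 m
    simp only [Finsupp.add_apply]
    by_cases h : A (m + 1)
    · have := h1.1 h; have := h2.1 h; omega
    · have := h1.2 h; have := h2.2 h; omega
  rw [height, sum_congr rfl fun m _ => this m, sum_add_distrib, Finsupp.add_apply, height, height]
  omega

/-- All exponents of the series lie in `M`. -/
def SupportedOn (M : AddSubmonoid (ℕ →₀ ℕ)) (F : MvPowerSeries ℕ K) : Prop :=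
  ∀ p, MvPowerSeries.coeff p F ≠ 0 → p ∈ M

lemma supportedOn_monomial {M : AddSubmonoid (ℕ →₀ ℕ)} {p : ℕ →₀ ℕ} (hp : p ∈ M) (c : K) :
    SupportedOn M (MvPowerSeries.monomial p c) := by
  intro q hq
  rwa [MvPowerSeries.eq_of_coeff_monomial_ne_zero hq]

lemma supportedOn_one (M : AddSubmonoid (ℕ →₀ ℕ)) : SupportedOn M (1 : MvPowerSeries ℕ K) :=
  supportedOn_monomial M.zero_mem 1

lemma SupportedOn.sub {M : AddSubmonoid (ℕ →₀ ℕ)} {F G : MvPowerSeries ℕ K}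
    (hF : SupportedOn M F) (hG : SupportedOn M G) : SupportedOn M (F - G) := by
  intro p hp
  by_cases h : MvPowerSeries.coeff p F = 0
  · refine hG p fun h' => hp ?_
    rw [map_sub, h, h', sub_zero]
  · exact hF p h

lemma SupportedOn.mul {M : AddSubmonoid (ℕ →₀ ℕ)} {F G : MvPowerSeries ℕ K}
    (hF : SupportedOn M F) (hG : SupportedOn M G) : SupportedOn M (F * G) := by
  intro p hp
  classical
  rw [MvPowerSeries.coeff_mul] at hp
  obtain ⟨q, hq, hne⟩ := exists_ne_zero_of_sum_ne_zero hp
  rw [← HasAntidiagonal.mem_antidiagonal.1 hq]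
  exact M.add_mem (hF _ (left_ne_zero_of_mul hne)) (hG _ (right_ne_zero_of_mul hne))

lemma collect_mul {n : ℕ} {A : ℕ → Prop} {F G : MvPowerSeries ℕ K}
    (hF : SupportedOn (signCone n A) F) (hG : SupportedOn (signCone n A) G) :
    collect K n (F * G) = collect K n F * collect K n G := by
  classical
  ext N
  rw [PowerSeries.coeff_mul, coeff_collect]
  simp only [coeff_collect, MvPowerSeries.coeff_mul, sum_mul_sum, ← sum_product']
  rw [sum_sigma', sum_sigma']
  -- Only nonzero terms are matched, since only their exponents are known to lie in the cone.
  refine sum_bij_ne_zero (fun x _ _ => ⟨(height n x.2.1, height n x.2.2), x.2⟩) ?_ ?_ ?_ ?_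
  · rintro ⟨p, a, b⟩ hx hne
    simp only [mem_sigma, HasAntidiagonal.mem_antidiagonal, mem_level] at hx
    obtain ⟨⟨h1, h2⟩, rfl⟩ := hx
    have ha := hF a (left_ne_zero_of_mul hne)
    have hb := hG b (right_ne_zero_of_mul hne)
    simp only [mem_sigma, HasAntidiagonal.mem_antidiagonal, mem_product, mem_level]
    exact ⟨by rw [← height_add ha hb, h2], ⟨ha.1, trivial⟩, hb.1, trivial⟩
  · rintro ⟨p, a, b⟩ hx hne ⟨p', a', b'⟩ hx' hne' h
    simp only [mem_sigma, HasAntidiagonal.mem_antidiagonal] at hx hx'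
    simp only [Sigma.mk.injEq, heq_eq_eq] at h
    obtain ⟨-, h⟩ := h
    rw [Prod.mk.injEq] at h
    obtain ⟨rfl, rfl⟩ := h
    obtain ⟨-, rfl⟩ := hx
    obtain ⟨-, rfl⟩ := hx'
    rfl
  · rintro ⟨⟨i, j⟩, a, b⟩ hx hne
    simp only [mem_sigma, HasAntidiagonal.mem_antidiagonal, mem_product, mem_level] at hx
    obtain ⟨hij, ⟨ha0, rfl⟩, hb0, rfl⟩ := hx
    have ha := hF a (left_ne_zero_of_mul hne)
    have hb := hG b (right_ne_zero_of_mul hne)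
    refine ⟨⟨a + b, a, b⟩, ?_, hne, rfl⟩
    simp only [mem_sigma, HasAntidiagonal.mem_antidiagonal, mem_level]
    exact ⟨⟨((signCone n A).add_mem ha hb).1, by rw [height_add ha hb, hij]⟩, trivial⟩
  · intros
    rfl

variable (K) in
/-- The series `t / (1 - t)`. -/
noncomputable def geometric : PowerSeries K := PowerSeries.X * PowerSeries.mk 1

/-- The indicator of an interval rises only at its left end and falls only at its right end. -/
lemma intervalVec_mem_signCone {n : ℕ} {A : ℕ → Prop} {e : ℕ × ℕ} (hn : e.2 ≤ n)
    (h1 : A e.1) (h2 : ¬ A e.2) : intervalVec e ∈ signCone n A := by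
  refine ⟨fun m hm => ?_, fun m => ⟨fun h => ?_, fun h => ?_⟩⟩
  · rw [intervalVec_apply, if_neg]; omega
  · have : m + 1 ≠ e.2 := fun h' => h2 (h' ▸ h)
    rw [intervalVec_apply, intervalVec_apply]
    split_ifs <;> omega
  · have : m + 1 ≠ e.1 := fun h' => h (h' ▸ h1)
    rw [intervalVec_apply, intervalVec_apply]
    split_ifs <;> omega

lemma height_intervalVec {n : ℕ} {e : ℕ × ℕ} (he : e.1 < e.2) (hn : e.2 ≤ n) :
    height n (intervalVec e) = 1 := by
  have : ∀ m, intervalVec e (m + 1) - intervalVec e m = if m + 1 = e.1 then 1 else 0 := by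
    intro m
    rw [intervalVec_apply, intervalVec_apply]
    split_ifs <;> omega
  simp only [height, this]
  obtain ⟨i, j⟩ := e
  rcases i with _ | i
  · dsimp only at he
    simp [intervalVec_apply, he]
  · dsimp only at he hn
    simp only [add_left_inj, sum_ite_eq', mem_range, intervalVec_apply]
    rw [if_neg (by omega), if_pos (by omega)]

lemma supportedOn_edgeSeries {n : ℕ} {A : ℕ → Prop} {e : ℕ × ℕ} (hn : e.2 ≤ n)
    (h1 : A e.1) (h2 : ¬ A e.2) : SupportedOn (signCone n A) (edgeSeries K e) := by
  intro p hp
  by_contra hmem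
  refine hp (coeff_edgeSeries_eq_zero K fun c hc => hmem ?_)
  rw [hc]
  exact nsmul_mem (intervalVec_mem_signCone hn h1 h2) c

lemma collect_one (n : ℕ) : collect K n 1 = 1 := by
  have := collect_monomial (K := K) (n := n) (p := 0) (by simp)
  simpa [height] using this

lemma collect_edgeSeries {n : ℕ} {e : ℕ × ℕ} (he : e.1 < e.2) (hn : e.2 ≤ n) :
    collect K n (edgeSeries K e) = geometric K := by
  have hA : intervalVec e ∈ signCone n (fun m => m = e.1) :=
    intervalVec_mem_signCone hn rfl (by omega)
  have h := congrArg (collect K n) (one_sub_mul_edgeSeries K he)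
  rw [collect_mul ((supportedOn_one _).sub (supportedOn_monomial hA 1))
    (supportedOn_edgeSeries hn rfl (by omega)), map_sub, collect_one, collect_monomial hA.1,
    height_intervalVec he hn, pow_one] at h
  have h' := PowerSeries.mk_one_mul_one_sub_eq_one K
  rw [geometric, ← h]
  linear_combination (-collect K n (edgeSeries K e)) * h'

/-- An alternating product of edges only depends on the number of its factors. -/
lemma collect_prod {ι : Type*} {n : ℕ} {A : ℕ → Prop} (s : Finset ι) (e : ι → ℕ × ℕ) (d : ι → ℕ)
    (h : ∀ i ∈ s, (e i).1 < (e i).2 ∧ (e i).2 ≤ n ∧ A (e i).1 ∧ ¬ A (e i).2) :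
    SupportedOn (signCone n A) (∏ i ∈ s, edgeSeries K (e i) ^ d i) ∧
      collect K n (∏ i ∈ s, edgeSeries K (e i) ^ d i) = geometric K ^ ∑ i ∈ s, d i := by
  classical
  induction s using Finset.induction_on with
  | empty => simp [supportedOn_one, collect_one]
  | insert i s hi ih =>
    obtain ⟨h1, h2⟩ := ih fun j hj => h j (mem_insert_of_mem hj)
    obtain ⟨hi1, hi2, hi3, hi4⟩ := h i (mem_insert_self _ _)
    have hs : ∀ k, SupportedOn (signCone n A) (edgeSeries K (e i) ^ k) ∧
        collect K n (edgeSeries K (e i) ^ k) = geometric K ^ k := by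
      intro k
      induction k with
      | zero => simp [supportedOn_one, collect_one]
      | succ k ihk =>
        have hu := supportedOn_edgeSeries (K := K) hi2 hi3 hi4
        rw [pow_succ, pow_succ]
        exact ⟨ihk.1.mul hu, by rw [collect_mul ihk.1 hu, ihk.2, collect_edgeSeries hi1 hi2]⟩
    rw [prod_insert hi, sum_insert hi, pow_add]
    exact ⟨(hs _).1.mul h1, by rw [collect_mul (hs _).1 h1, (hs _).2, h2]⟩

lemma collect_C_mul (n : ℕ) (c : K) (F : MvPowerSeries ℕ K) :
    collect K n (MvPowerSeries.C c * F) = PowerSeries.C c * collect K n F := by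
  ext N
  simp only [coeff_collect, PowerSeries.coeff_C_mul, MvPowerSeries.coeff_C_mul, mul_sum]

variable (K) in
/-- Evaluation of polynomials at `t / (1 - t)`. -/
noncomputable def evalGeometric : Polynomial K →+* PowerSeries K :=
  Polynomial.eval₂RingHom PowerSeries.C (geometric K)

lemma evalGeometric_X : evalGeometric K Polynomial.X = geometric K := Polynomial.eval₂_X _ _

lemma evalGeometric_C (c : K) : evalGeometric K (Polynomial.C c) = PowerSeries.C c :=
  Polynomial.eval₂_C _ _

/-- The series `t / (1 - t)` is nonzero without constant term, so the coefficients of a polynomial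
in the kernel vanish one by one, dividing by the variable each time. -/
lemma evalGeometric_injective [NoZeroDivisors K] [Nontrivial K] :
    Function.Injective (evalGeometric K) := by
  have hc : PowerSeries.constantCoeff (geometric K) = 0 := by simp [geometric]
  have h0 : geometric K ≠ 0 := by
    intro h
    have := congrArg (PowerSeries.coeff 1) h
    rw [geometric, ← zero_add 1, PowerSeries.coeff_succ_X_mul] at this
    simp at this
  have hQ0 : ∀ Q : Polynomial K, evalGeometric K Q = 0 → Q.coeff 0 = 0 := by
    intro Q hQ
    have h := congrArg PowerSeries.constantCoeff hQ
    rw [← Polynomial.divX_mul_X_add Q, map_add, map_mul, evalGeometric_X, evalGeometric_C] at h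
    simpa [hc] using h
  have key : ∀ (k : ℕ) (Q : Polynomial K), evalGeometric K Q = 0 → Q.coeff k = 0 := by
    intro k
    induction k with
    | zero => exact hQ0
    | succ k ih =>
      intro Q hQ
      rw [← Polynomial.coeff_divX]
      refine ih _ ?_
      have h := hQ
      rw [← Polynomial.divX_mul_X_add Q, hQ0 Q hQ, map_zero, add_zero, map_mul,
        evalGeometric_X] at h
      exact (mul_eq_zero.1 h).resolve_right h0
  refine (injective_iff_map_eq_zero _).2 fun Q hQ => ?_
  ext k
  rw [key k Q hQ, Polynomial.coeff_zero]

end Series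

/-! ### The invariant of the path -/

section Evaluation

variable {K : Type*} [CommRing K]

variable (K) in
/-- The polynomial in which the coefficient of `z ^ k` is the number of families of `k` pairs. -/
noncomputable def familyPolynomial (n : ℕ) : Polynomial K :=
  ∑ G ∈ fullFamilies 0 n, Polynomial.X ^ G.card

lemma coeff_familyPolynomial_succ (n k : ℕ) :
    (familyPolynomial K n).coeff (k + 1) = (fullFamilyCount n k : K) := by
  rw [familyPolynomial, Polynomial.finsetSum_coeff, fullFamilyCount, card_filter]
  push_cast
  refine sum_congr rfl fun G _ => ?_
  rw [Polynomial.coeff_X_pow]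
  exact if_congr eq_comm rfl rfl

lemma coeff_familyPolynomial_zero (n : ℕ) : (familyPolynomial K n).coeff 0 = 0 := by
  rw [familyPolynomial, Polynomial.finsetSum_coeff]
  refine sum_eq_zero fun G hG => ?_
  rw [Polynomial.coeff_X_pow, if_neg]
  exact (card_pos.2 ⟨_, (mem_fullFamilies.1 hG).2.2⟩).ne

/-- The height series of the path. -/
lemma collect_path [NoZeroDivisors K] [Nontrivial K] {n : ℕ} (hn : 1 ≤ n) :
    collect K n (∏ m ∈ range n, edgeSeries K (m, m + 1)) =
      evalGeometric K (familyPolynomial K n) := by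
  have h := (fullSum_eq_prod (u := edgeSeries K)
    (fun i j hij => edgeSeries_ne_zero (e := (i, j)) hij)
    (fun i j k hij hjk => edgeSeries_mul K hij hjk) n 0).1
  simp only [zero_add] at h
  rw [← h, fullSum', if_neg (by omega), fullSum, familyPolynomial, map_sum, map_sum]
  refine sum_congr rfl fun G hG => ?_
  obtain ⟨hs, hc, -⟩ := mem_fullFamilies.1 hG
  -- Positive signs are put at the left ends; compatibility keeps right ends out of this set.
  have hp := (collect_prod (K := K) (n := n) (A := fun v => ∃ f ∈ G, f.1 = v) G id (fun _ => 1)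
    (fun e he => by
      have h1 := mem_pairsIn.1 (hs he)
      refine ⟨h1.2.1, by simp only [id]; omega, ⟨e, he, rfl⟩, ?_⟩
      rintro ⟨f, hf, hfe⟩
      have h2 := mem_pairsIn.1 (hs hf)
      have h3 := hc e he f hf
      simp only [id] at hfe
      omega)).2
  rw [map_pow, evalGeometric_X]
  simpa using hp

end Evaluation

/-! ### Reduction trees -/

section Trees

variable {n : ℕ}

/-- The root `e_i - e_j` in the basis of the simple roots. -/
noncomputable def rootVec (e : Edge n) : ℕ →₀ ℚ := ∑ m ∈ Ico e.1.1.val e.1.2.val, Finsupp.single m 1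

lemma rootVec_add {i j k : Fin (n + 1)} (hij : i < j) (hjk : j < k) :
    rootVec (edge hij) + rootVec (edge hjk) = rootVec (edge (hij.trans hjk)) :=
  sum_Ico_consecutive _ (le_of_lt hij) (le_of_lt hjk)

/-- The edges of the graph are linearly independent as roots. -/
def Graph.IsIndependent (G : Graph n) : Prop :=
  LinearIndepOn ℚ (rootVec (n := n)) (G : Set (Edge n))

lemma notMem_span_erase {G : Graph n} (hG : Graph.IsIndependent G) {e : Edge n} (he : e ∈ G) :
    rootVec e ∉ Submodule.span ℚ (rootVec '' (G.erase e : Set (Edge n))) := by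
  have h : LinearIndepOn ℚ (rootVec (n := n)) (insert e (G.erase e : Set (Edge n))) := by
    rw [← coe_insert, insert_erase he]; exact hG
  exact h.notMem_span_of_insert (by simp)

lemma edge_ne_left {i j k : Fin (n + 1)} (hij : i < j) (hjk : j < k) :
    edge hij ≠ edge (hij.trans hjk) := fun h =>
  hjk.ne (congrArg (fun e : Edge n => e.1.2) h)

lemma edge_ne_right {i j k : Fin (n + 1)} (hij : i < j) (hjk : j < k) :
    edge hjk ≠ edge (hij.trans hjk) := fun h =>
  hij.ne' (congrArg (fun e : Edge n => e.1.1) h)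

lemma edge_ne_of_consecutive {i j k : Fin (n + 1)} (hij : i < j) (hjk : j < k) :
    edge hij ≠ edge hjk := fun h =>
  hij.ne (congrArg (fun e : Edge n => e.1.1) h)

/-- The three roots satisfy a linear relation. Hence the edge added by a reduction is new, and edge
sets lose no multiplicity compared with monomials. -/
lemma edge_trans_notMem {G : Graph n} (hG : Graph.IsIndependent G) {i j k : Fin (n + 1)}
    (hij : i < j) (hjk : j < k) (h₁ : edge hij ∈ G) (h₂ : edge hjk ∈ G) :
    edge (hij.trans hjk) ∉ G := by
  intro h
  refine notMem_span_erase hG h ?_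
  rw [← rootVec_add hij hjk]
  refine Submodule.add_mem _ (Submodule.subset_span ⟨_, ?_, rfl⟩)
    (Submodule.subset_span ⟨_, ?_, rfl⟩)
  · exact mem_erase.2 ⟨edge_ne_left hij hjk, h₁⟩
  · exact mem_erase.2 ⟨edge_ne_right hij hjk, h₂⟩

/-- Replacing one root by its sum with another is invertible, so independence passes to the
children. -/
lemma isIndependent_insert_erase {G : Graph n} (hG : Graph.IsIndependent G) {e f g : Edge n}
    (he : e ∈ G) (hf : f ∈ G) (hef : e ≠ f) (hg : rootVec e + rootVec f = rootVec g) :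
    Graph.IsIndependent (insert g (G.erase f)) := by
  have hs : LinearIndepOn ℚ (rootVec (n := n)) (G.erase f : Set (Edge n)) :=
    LinearIndepOn.mono hG (by exact_mod_cast erase_subset f G)
  rw [Graph.IsIndependent, coe_insert]
  refine hs.insert fun hmem => notMem_span_erase hG hf ?_
  rw [eq_sub_iff_add_eq'.2 hg]
  exact Submodule.sub_mem _ hmem (Submodule.subset_span ⟨e, mem_erase.2 ⟨hef, he⟩, rfl⟩)

lemma isIndependent_pathGraph : Graph.IsIndependent (pathGraph n) := by
  have hinj : Function.Injective fun i : Fin n => i.val := Fin.val_injective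
  have h : LinearIndependent ℚ fun i : Fin n => (Finsupp.single i.val (1 : ℚ) : ℕ →₀ ℚ) :=
    (Finsupp.linearIndependent_single_one ℚ ℕ).comp _ hinj
  have h' : (fun i : Fin n => (Finsupp.single i.val (1 : ℚ) : ℕ →₀ ℚ)) =
      rootVec ∘ fun i : Fin n => edge (Fin.castSucc_lt_succ (i := i)) := by
    funext i
    simp [rootVec, edge]
  rw [h'] at h
  have hinj' : Function.Injective fun i : Fin n => edge (Fin.castSucc_lt_succ (i := i)) :=
    fun i j h => Fin.castSucc_injective n (congrArg (fun e : Edge n => e.1.1) h)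
  rw [Graph.IsIndependent, pathGraph, coe_image, coe_univ, Set.image_univ]
  exact (linearIndepOn_range_iff hinj' _).2 h

lemma edgeVal_edge {i j : Fin (n + 1)} (h : i < j) : edgeVal (edge h) = (i.val, j.val) := rfl

/-- The product of the edge series of a node is the sum of those of its children, by
`edgeSeries_mul`; a leaf is alternating and collects to a power of `t / (1 - t)`. -/
lemma exists_leafCount_polynomial (K : Type*) [CommRing K] [NoZeroDivisors K]
    [Nontrivial K] {G : Graph n}
    (T : ReductionTree G) (hG : Graph.IsIndependent G) :
    ∃ Q : Polynomial K, (∀ k, Q.coeff k = (T.leafCount k : K)) ∧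
      collect K n (∏ e ∈ G, edgeSeries K (edgeVal e)) = evalGeometric K Q := by
  induction T with
  | leaf G hA =>
    refine ⟨Polynomial.X ^ G.card, fun k => ?_, ?_⟩
    · rw [Polynomial.coeff_X_pow, ReductionTree.leafCount]
      push_cast
      exact if_congr eq_comm rfl rfl
    · have hp := (collect_prod (K := K) (n := n) (A := fun v => ∃ f ∈ G, (edgeVal f).1 = v) G
        edgeVal (fun _ => 1) (fun e he => by
          refine ⟨edgeVal_lt e, edgeVal_le e, ⟨e, he, rfl⟩, ?_⟩
          rintro ⟨⟨⟨j', k⟩, hjk⟩, hf, hfe⟩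
          obtain ⟨⟨i, j⟩, hij⟩ := e
          obtain rfl : j' = j := Fin.ext hfe
          exact hA i j' k hij hjk ⟨he, hf⟩)).2
      rw [map_pow, evalGeometric_X]
      simpa using hp
  | node G i j k hij hjk h₁ h₂ T₁ T₂ T₃ ih₁ ih₂ ih₃ =>
    have hik := edge_trans_notMem hG hij hjk h₁ h₂
    have hne := edge_ne_of_consecutive hij hjk
    have hadd := rootVec_add hij hjk
    have hG₁ := isIndependent_insert_erase hG h₁ h₂ hne hadd
    have hG₂ := isIndependent_insert_erase hG h₂ h₁ hne.symm ((add_comm _ _).trans hadd)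
    -- The third child is a subgraph of the second.
    have hG₃ : Graph.IsIndependent
        (insert (edge (hij.trans hjk)) ((G.erase (edge hij)).erase (edge hjk))) :=
      LinearIndepOn.mono hG₂ (by exact_mod_cast insert_subset_insert _ (erase_subset _ _))
    obtain ⟨Q₁, hQ₁, hc₁⟩ := ih₁ hG₁
    obtain ⟨Q₂, hQ₂, hc₂⟩ := ih₂ hG₂
    obtain ⟨Q₃, hQ₃, hc₃⟩ := ih₃ hG₃
    refine ⟨Q₁ + Q₂ + Q₃, fun m => ?_, ?_⟩
    · rw [Polynomial.coeff_add, Polynomial.coeff_add, hQ₁, hQ₂, hQ₃, ReductionTree.leafCount]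
      push_cast
      rfl
    · rw [map_add, map_add, ← hc₁, ← hc₂, ← hc₃, ← map_add, ← map_add]
      congr 1
      have h₂' : edge hjk ∈ G.erase (edge hij) := mem_erase.2 ⟨hne.symm, h₂⟩
      have h₁' : edge hij ∈ G.erase (edge hjk) := mem_erase.2 ⟨hne, h₁⟩
      rw [prod_insert fun h => hik (mem_of_mem_erase h),
        prod_insert fun h => hik (mem_of_mem_erase h),
        prod_insert fun h => hik (mem_of_mem_erase (mem_of_mem_erase h)),
        ← mul_prod_erase G _ h₁, ← mul_prod_erase _ _ h₂', ← mul_prod_erase _ _ h₁',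
        erase_right_comm (a := edge hjk) (b := edge hij)]
      have := edgeSeries_mul K (i := i.val) (j := j.val) (k := k.val) hij hjk
      simp only [edgeVal_edge]
      linear_combination (∏ e ∈ (G.erase (edge hij)).erase (edge hjk),
        edgeSeries K (edgeVal e)) * this

lemma prod_pathGraph {R : Type*} [CommRing R] (u : ℕ × ℕ → R) :
    ∏ e ∈ pathGraph n, u (edgeVal e) = ∏ m ∈ range n, u (m, m + 1) := by
  rw [pathGraph, prod_image, prod_range]
  · rfl
  · intro i _ j _ h
    exact Fin.castSucc_injective n (congrArg (fun e : Edge n => e.1.1) h)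

theorem leafCount_pathGraph (hn : 1 ≤ n) (k : ℕ) (T : ReductionTree (pathGraph n)) :
    T.leafCount (k + 1) = fullFamilyCount n k := by
  obtain ⟨Q, hQ, hc⟩ := exists_leafCount_polynomial ℚ T isIndependent_pathGraph
  rw [prod_pathGraph, collect_path hn] at hc
  have h := hQ (k + 1)
  rw [← evalGeometric_injective hc, coeff_familyPolynomial_succ] at h
  exact_mod_cast h.symm

end Trees

/-! ### Reduced forms -/

section ReducedForms

open Polynomial

variable {n : ℕ}

/-- The homomorphism that substitutes `β y^{e_i - e_j} / (1 - y^{e_i - e_j})` for `x_{ij}`. -/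
noncomputable def toSeries (n : ℕ) : Poly n →+* MvPowerSeries ℕ ℚ[X] :=
  MvPolynomial.eval₂Hom MvPowerSeries.C
    fun e => MvPowerSeries.C X * edgeSeries ℚ[X] (edgeVal e)

lemma toSeries_x {i j : Fin (n + 1)} (h : i < j) :
    toSeries n (x h) = MvPowerSeries.C X * edgeSeries ℚ[X] (i.val, j.val) :=
  MvPolynomial.eval₂Hom_X' _ _ _

lemma toSeries_beta : toSeries n (beta n) = MvPowerSeries.C X :=
  MvPolynomial.eval₂Hom_C _ _ _

/-- The factor `β` in the substitution makes the rule homogeneous: each of its terms acquires `β ^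
2`. -/
lemma ReducesTo.toSeries_eq {p p' : Poly n} (h : ReducesTo p p') :
    toSeries n p' = toSeries n p := by
  obtain ⟨i, j, k, hij, hjk, d, a, c, -, -, rfl⟩ := h
  have := edgeSeries_mul ℚ[X] (i := i.val) (j := j.val) (k := k.val) hij hjk
  simp only [map_add, map_sub, map_mul, toSeries_x, toSeries_beta]
  linear_combination (-toSeries n (term c a d) *
    MvPowerSeries.C X ^ 2) * this

lemma toSeries_pathMonomial :
    toSeries n (pathMonomial n) = MvPowerSeries.C (X ^ n) *
      ∏ m ∈ range n, edgeSeries ℚ[X] (m, m + 1) := by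
  rw [pathMonomial, map_prod, prod_range]
  simp only [toSeries_x, prod_mul_distrib, prod_const, card_univ, Fintype.card_fin, map_pow]
  rfl

/-- Identify all the variables `x_{ij}`. -/
noncomputable def identify (n : ℕ) : Poly n →+* ℚ[X][X] :=
  MvPolynomial.eval₂Hom C fun _ => X

lemma eval_one_identify (P : Poly n) :
    (identify n P).eval 1 = MvPolynomial.eval (fun _ => (1 : ℚ[X])) P := by
  have h : (Polynomial.evalRingHom (1 : ℚ[X])).comp (identify n) =
      MvPolynomial.eval (fun _ => (1 : ℚ[X])) := by
    refine MvPolynomial.ringHom_ext (fun c => ?_) fun e => ?_ <;> simp [identify]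
  exact DFunLike.congr_fun h P

/-- The support of each term is alternating, so a term of degree `d` collects to its coefficient
times `(β t / (1 - t))^d`. This is why the variable is rescaled by `β`. -/
lemma collect_toSeries {P : Poly n} (hP : IsFullyReduced P) :
    collect ℚ[X] n (toSeries n P) =
      evalGeometric ℚ[X] ((identify n P).comp (C X * X)) := by
  conv_lhs => rw [P.as_sum]
  conv_rhs => rw [P.as_sum]
  rw [map_sum, map_sum, map_sum, Polynomial.sum_comp, map_sum]
  refine sum_congr rfl fun d hd => ?_
  have hp := (collect_prod (K := ℚ[X]) (n := n)
    (A := fun v => ∃ f ∈ d.support, (edgeVal f).1 = v) d.support edgeVal d (fun e he => by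
      refine ⟨edgeVal_lt e, edgeVal_le e, ⟨e, he, rfl⟩, ?_⟩
      rintro ⟨⟨⟨j', k⟩, hjk⟩, hf, hfe⟩
      obtain ⟨⟨i, j⟩, hij⟩ := e
      obtain rfl : j' = j := Fin.ext hfe
      have hij' : i < j' := hij
      have hjk' : j' < k := hjk
      refine hP d hd i j' k hij' hjk' fun g => ?_
      have hne := edge_ne_of_consecutive hij' hjk'
      have h1 : 1 ≤ d (edge hij') := Nat.one_le_iff_ne_zero.2 (Finsupp.mem_support_iff.1 he)
      have h2 : 1 ≤ d (edge hjk') := Nat.one_le_iff_ne_zero.2 (Finsupp.mem_support_iff.1 hf)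
      rw [Finsupp.add_apply, Finsupp.single_apply, Finsupp.single_apply]
      split_ifs with h3 h4 h4
      · exact absurd (h3.trans h4.symm) hne
      · rw [← h3]; exact h1
      · rw [← h4]; simpa using h2
      · exact Nat.zero_le _)).2
  rw [toSeries, identify, MvPolynomial.coe_eval₂Hom, MvPolynomial.coe_eval₂Hom,
    MvPolynomial.eval₂_monomial, MvPolynomial.eval₂_monomial, Finsupp.prod, Finsupp.prod]
  simp only [mul_pow, prod_mul_distrib, prod_pow_eq_pow_sum]
  rw [← map_pow, collect_C_mul, collect_C_mul, hp]
  simp only [mul_comp, C_comp, pow_comp, X_comp, map_mul, mul_pow, map_pow, evalGeometric_C,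
    evalGeometric_X]

theorem identify_comp_eq (hn : 1 ≤ n) {P : Poly n} (hP : IsReducedForm (pathMonomial n) P) :
    (identify n P).comp (C X * X) = C (X ^ n) * familyPolynomial ℚ[X] n := by
  have h : toSeries n P = toSeries n (pathMonomial n) := by
    obtain ⟨h, -⟩ := hP
    induction h with
    | refl => rfl
    | tail _ h ih => rw [h.toSeries_eq, ih]
  refine evalGeometric_injective ?_
  rw [← collect_toSeries hP.2, h, toSeries_pathMonomial, collect_C_mul,
    collect_path hn, map_mul, evalGeometric_C]

theorem eval_reducedForm (hn : 1 ≤ n) {P : Poly n} (hP : IsReducedForm (pathMonomial n) P) :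
    MvPolynomial.eval (fun _ => (1 : ℚ[X])) P =
      ∑ m ∈ range n, C (fullFamilyCount n (n - m - 1) : ℚ) * X ^ m := by
  have hcomp := identify_comp_eq hn hP
  have hcoeff : ∀ m, (identify n P).coeff m * X ^ m =
      X ^ n * (familyPolynomial ℚ[X] n).coeff m := by
    intro m
    have := congrArg (fun Q => Q.coeff m) hcomp
    simpa only [comp_C_mul_X_coeff, coeff_C_mul] using this
  have h0 : (identify n P).coeff 0 = 0 := by
    have := hcoeff 0
    rwa [coeff_familyPolynomial_zero, pow_zero, mul_one, mul_zero] at this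
  have hlow : ∀ k, k < n → (identify n P).coeff (k + 1) =
      C (fullFamilyCount n k : ℚ) * X ^ (n - 1 - k) := by
    intro k hk
    have := hcoeff (k + 1)
    rw [coeff_familyPolynomial_succ] at this
    -- Degree `k + 1` carries `β ^ (k + 1)` on the left and `β ^ n` on the right, which leaves `β ^
    -- (n - 1 - k)`.
    refine mul_right_cancel₀ (pow_ne_zero (k + 1) (X_ne_zero (R := ℚ))) (this.trans ?_)
    have hpow : (X : ℚ[X]) ^ n = X ^ (n - 1 - k) * X ^ (k + 1) := by
      rw [← pow_add]
      congr 1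
      omega
    rw [hpow, map_natCast]
    ring
  have hhigh : ∀ k, n ≤ k → (identify n P).coeff (k + 1) = 0 := by
    intro k hk
    -- The Kirkman–Cayley formula contains `(n - 1).choose k`, which vanishes here.
    have hz : fullFamilyCount n k = 0 := by
      have := fullFamilyCount_eq hn k
      rw [kirkmanCayley_eq_zero (by omega)] at this
      exact_mod_cast this
    have := hcoeff (k + 1)
    rw [coeff_familyPolynomial_succ, hz, Nat.cast_zero, mul_zero] at this
    exact (mul_eq_zero.1 this).resolve_right (pow_ne_zero _ X_ne_zero)
  have hdeg : (identify n P).natDegree < n + 1 := by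
    rw [Nat.lt_succ_iff, natDegree_le_iff_coeff_eq_zero]
    intro m hm
    obtain ⟨k, rfl⟩ : ∃ k, m = k + 1 := ⟨m - 1, by omega⟩
    exact hhigh k (by omega)
  rw [← eval_one_identify, eval_eq_sum_range' hdeg, sum_range_succ', h0, zero_mul, add_zero,
    ← sum_range_reflect]
  refine sum_congr rfl fun m hm => ?_
  rw [mem_range] at hm
  rw [hlow _ (by omega), one_pow, mul_one, Nat.sub_right_comm,
    show n - 1 - (n - m - 1) = m by omega]

end ReducedForms

/-! ### The closed formula and the Catalan number -/

lemma kirkmanCayley_pred {n : ℕ} (hn : 1 ≤ n) (k : ℕ) :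
    kirkmanCayley (n - 1) k =
      1 / ((n : ℚ) + 1) * (Nat.choose (n + k + 1) n : ℚ) * (Nat.choose (n - 1) k : ℚ) := by
  obtain ⟨l, rfl⟩ := Nat.exists_eq_add_of_le' hn
  rw [kirkmanCayley, Nat.add_sub_cancel, add_assoc (l + 1) k 1]
  push_cast
  rw [show (l : ℚ) + 1 + 1 = l + 2 by ring]
  ring

lemma fullFamilyCount_pred {n : ℕ} (hn : 1 ≤ n) : fullFamilyCount n (n - 1) = catalan n := by
  have h := fullFamilyCount_eq hn (n - 1)
  have h2 := succ_mul_catalan_eq_centralBinom n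
  rw [kirkmanCayley_pred hn, Nat.choose_self, show n + (n - 1) + 1 = 2 * n by omega,
    ← Nat.centralBinom_eq_two_mul_choose, ← h2] at h
  have hn' : ((n : ℚ) + 1) ≠ 0 := by positivity
  push_cast at h
  rw [mul_one, one_div, inv_mul_cancel_left₀ hn'] at h
  exact_mod_cast h

end SubdivisionAlgebra

theorem mainTheorem10 (n : ℕ) (hn : 1 ≤ n) :
    (∀ P : SubdivisionAlgebra.Poly n,
      SubdivisionAlgebra.IsReducedForm (SubdivisionAlgebra.pathMonomial n) P →
        MvPolynomial.eval (fun _ => (1 : Polynomial ℚ)) P =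
            ∑ m ∈ Finset.range n,
              Polynomial.C (SubdivisionAlgebra.dissectionNumber n (n - m - 1) : ℚ)
                * Polynomial.X ^ m ∧
        (MvPolynomial.eval (fun _ => (1 : Polynomial ℚ)) P).eval 0 = (catalan n : ℚ)) ∧
    (∀ k : ℕ,
      (SubdivisionAlgebra.dissectionNumber n k : ℚ) =
          1 / ((n : ℚ) + 1) * (Nat.choose (n + k + 1) n : ℚ) * (Nat.choose (n - 1) k : ℚ) ∧
      Nonempty (SubdivisionAlgebra.noncrossingAlternatingForests n (k + 1) ≃
        SubdivisionAlgebra.dissections n k) ∧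
      (SubdivisionAlgebra.noncrossingAlternatingForests n (k + 1)).ncard =
        SubdivisionAlgebra.dissectionNumber n k ∧
      ∀ T : SubdivisionAlgebra.ReductionTree (SubdivisionAlgebra.pathGraph n),
        T.leafCount (k + 1) = SubdivisionAlgebra.dissectionNumber n k) := by
  have hs : ∀ k, SubdivisionAlgebra.dissectionNumber n k =
      SubdivisionAlgebra.fullFamilyCount n k :=
    fun k => SubdivisionAlgebra.ncard_dissections hn k
  refine ⟨fun P hP => ?_, fun k => ⟨?_, ?_, ?_, fun T => ?_⟩⟩
  · have h := SubdivisionAlgebra.eval_reducedForm hn hP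
    simp only [hs]
    refine ⟨h, ?_⟩
    -- At `β = 0` only `m = 0` survives: the dissections with `n - 1` diagonals, that is,
    -- triangulations.
    rw [h, Polynomial.eval_finsetSum, Finset.sum_eq_single_of_mem 0 (Finset.mem_range.2 hn)]
    · simp [SubdivisionAlgebra.fullFamilyCount_pred hn]
    · intro m _ hm
      simp [hm]
  · rw [hs, SubdivisionAlgebra.fullFamilyCount_eq hn, SubdivisionAlgebra.kirkmanCayley_pred hn]
  · have h : (SubdivisionAlgebra.noncrossingAlternatingForests n (k + 1)).ncard =
        (SubdivisionAlgebra.dissections n k).ncard := by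
      rw [SubdivisionAlgebra.ncard_noncrossingAlternatingForests,
        SubdivisionAlgebra.ncard_dissections hn]
    -- The bijection is obtained from equal cardinalities of finite sets.
    exact Finite.card_eq.1 h
  · rw [hs, SubdivisionAlgebra.ncard_noncrossingAlternatingForests]
  · rw [hs, SubdivisionAlgebra.leafCount_pathGraph hn]
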